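/- Let $\Bbbk$ be a field of characteristic different from $2$. A graded connected Hopf algebra over $\Bbbk$ is a Hopf algebra $H=\bigoplus_{n\ge 0}H_n$ with $H_0=\Bbbk\cdot 1$ all of whose structure maps preserve the grading; a morphism of graded Hopf algebras is a morphism of Hopf algebras that preserves the grading. A character of $H$ is an algebra morphism $\varphi:H\to\Bbbk$; characters form a group under convolution $\varphi\psi=m_\Bbbk\circ(\varphi\otimes\psi)\circ\Delta$. Put $\bar\varphi(h)=(-1)^n\varphi(h)$ for $h\in H_n$; $\varphi$ is even if $\bar\varphi=\varphi$ and odd if $\bar\varphi=\varphi^{-1}$. For characters $\varphi,\psi$ let $S(\varphi,\psi)$ be the largest graded subcoalgebra of $H$ on which $\varphi$ and $\psi$ agree. Let $\mathcal{Q}\mathit{Sym}$ be the algebra of quasi-symmetric functions, i.e. the span in the power series in $x_1,x_2,\dots$ of $M_{(a_1,\dots,a_r)}=\sum_{i_1<\dots<i_r}x_{i_1}^{a_1}\cdots x_{i_r}^{a_r}$ over all compositions, with $\deg M_\alpha=|\alpha|$, $\Delta(M_\alpha)=\sum_{\alpha=\beta\gamma}M_\beta\otimes M_\gamma$ (deconcatenation),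 and the constant term as counit. Let $\zeta_Q$ be the character of $\mathcal{Q}\mathit{Sym}$ that sets $x_1=1$ and $x_i=0$ for $i\ne 1$. Let $\Pi_+=S(\bar\zeta_Q,\zeta_Q)$ and $\Pi_-=S(\bar\zeta_Q,\zeta_Q^{-1})$ be its even and odd subalgebras. Then $\mathcal{Q}\mathit{Sym}$, $\Pi_+$ and $\Pi_-$ are graded connected Hopf algebras with finite-dimensional homogeneous components. There is a unique decomposition $\zeta_Q=(\zeta_Q)_+(\zeta_Q)_-$ of $\zeta_Q$ into an even character $(\zeta_Q)_+$ and an odd character $(\zeta_Q)_-$, and there are unique morphisms of graded Hopf algebras $\Psi_\pm:\mathcal{Q}\mathit{Sym}\to\mathcal{Q}\mathit{Sym}$ with $\zeta_Q\circ\Psi_\pm=(\zeta_Q)_\pm$; they take values in $\Pi_\pm$. With the projections $\Psi_\pm:\mathcal{Q}\mathit{Sym}\to\Pi_\pm$, the Hopf algebra $\mathcal{Q}\mathit{Sym}$ is the product of $\Pi_+$ and $\Pi_-$ in the category of graded connected Hopf algebras over $\Bbbk$: for every graded connected Hopf algebra $H$ (whether or not its homogeneous components are finite-dimensional) and all morphisms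 of graded Hopf algebras $\alpha_+:H\to\Pi_+$ and $\alpha_-:H\to\Pi_-$ there is a unique morphism of graded Hopf algebras $\alpha:H\to\mathcal{Q}\mathit{Sym}$ with $\Psi_+\circ\alpha=\alpha_+$ and $\Psi_-\circ\alpha=\alpha_-$. -/

import Mathlib

open TensorProduct

noncomputable section

namespace CombHopf

open WithConv

section General

variable {k : Type*} [Field k] {H : Type*}

/-- The image of `C ⊗ D` in `H ⊗ H`, for linear subspaces `C`, `D` of `H`. -/
def tensorSub [Ring H] [Algebra k H] (C D : Submodule k H) : Submodule k (H ⊗[k] H) :=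
  LinearMap.range (TensorProduct.map C.subtype D.subtype)

theorem tmul_mem_tensorSub [Ring H] [Algebra k H] {C D : Submodule k H} {x y : H}
    (hx : x ∈ C) (hy : y ∈ D) : x ⊗ₜ[k] y ∈ tensorSub C D :=
  ⟨(⟨x, hx⟩ : C) ⊗ₜ (⟨y, hy⟩ : D), by simp⟩

theorem tensorSub_le [Ring H] [Algebra k H] {C D : Submodule k H}
    {P : Submodule k (H ⊗[k] H)} (h : ∀ x ∈ C, ∀ y ∈ D, x ⊗ₜ[k] y ∈ P) : tensorSub C D ≤ P := by
  rintro _ ⟨t, rfl⟩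
  induction t with
  | zero => simp
  | tmul x y => simpa using h x x.2 y y.2
  | add x y hx hy => simpa using P.add_mem hx hy

theorem tensorSub_mono [Ring H] [Algebra k H] {C D C' D' : Submodule k H} (hC : C ≤ C')
    (hD : D ≤ D') : tensorSub C D ≤ tensorSub C' D' :=
  tensorSub_le fun _ hx _ hy => tmul_mem_tensorSub (hC hx) (hD hy)

/-- A linear subspace `C` of `H` is a subcoalgebra if `Δ(C) ⊆ C ⊗ C`. -/
def IsSubcoalgebra [Ring H] [Bialgebra k H] (C : Submodule k H) : Prop :=
  ∀ h ∈ C, Coalgebra.comul (R := k) h ∈ tensorSub C C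

/-- A graded connected Hopf algebra `H = ⨁ 𝒜 n`, with `𝒜 0 = k · 1` and all structure maps
(including the antipode) homogeneous of degree zero. -/
structure IsGradedConnectedHopf [Ring H] [HopfAlgebra k H] (𝒜 : ℕ → Submodule k H) : Prop where
  internal : DirectSum.IsInternal 𝒜
  one_mem : (1 : H) ∈ 𝒜 0
  mul_mem : ∀ m n, ∀ x ∈ 𝒜 m, ∀ y ∈ 𝒜 n, x * y ∈ 𝒜 (m + n)
  comul_mem : ∀ n, ∀ x ∈ 𝒜 n, Coalgebra.comul (R := k) x ∈
    ⨆ p ∈ Finset.HasAntidiagonal.antidiagonal n, tensorSub (𝒜 p.1) (𝒜 p.2)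
  counit_eq_zero : ∀ n, n ≠ 0 → ∀ x ∈ 𝒜 n, Coalgebra.counit (R := k) x = 0
  antipode_mem : ∀ n, ∀ x ∈ 𝒜 n, HopfAlgebra.antipode k x ∈ 𝒜 n
  connected : 𝒜 0 = Submodule.span k {(1 : H)}

/-- A linear map preserves given gradings if it maps degree `n` to degree `n` for all `n`. -/
def PreservesGrading {A B : Type*} [Ring A] [Algebra k A] [Ring B] [Algebra k B]
    (𝒜 : ℕ → Submodule k A) (ℬ : ℕ → Submodule k B) (f : A → B) : Prop :=
  ∀ n, ∀ x ∈ 𝒜 n, f x ∈ ℬ n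

/-- The canonical involution `h ↦ (-1)ⁿ h` for `h` homogeneous of degree `n`, as a linear map. -/
def barLinear [Ring H] [Algebra k H] (𝒜 : ℕ → Submodule k H) [GradedAlgebra 𝒜] : H →ₗ[k] H :=
  DirectSum.toModule k ℕ H (fun n => (-1 : k) ^ n • (𝒜 n).subtype) ∘ₗ
    (DirectSum.decomposeLinearEquiv 𝒜).toLinearMap

theorem barLinear_of_mem [Ring H] [Algebra k H] (𝒜 : ℕ → Submodule k H) [GradedAlgebra 𝒜]
    {n : ℕ} {x : H} (hx : x ∈ 𝒜 n) : barLinear 𝒜 x = (-1 : k) ^ n • x := by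
  lift x to 𝒜 n using hx
  simp [barLinear]

/-- The canonical involution `h ↦ (-1)ⁿ h` of a graded algebra, as a morphism of algebras. -/
def bar [Ring H] [Algebra k H] (𝒜 : ℕ → Submodule k H) [GradedAlgebra 𝒜] : H →ₐ[k] H :=
  AlgHom.ofLinearMap (barLinear 𝒜)
    (by rw [barLinear_of_mem 𝒜 (SetLike.GradedOne.one_mem (A := 𝒜)), pow_zero, one_smul])
    (fun x y => by
      induction x using DirectSum.Decomposition.inductionOn 𝒜 with
      | zero => simp
      | add a b ha hb => rw [add_mul, map_add, ha, hb, map_add, add_mul]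
      | homogeneous a =>
        induction y using DirectSum.Decomposition.inductionOn 𝒜 with
        | zero => simp
        | add c d hc hd => rw [mul_add, map_add, hc, hd, map_add, mul_add]
        | homogeneous c =>
          rw [barLinear_of_mem 𝒜 a.2, barLinear_of_mem 𝒜 c.2,
            barLinear_of_mem 𝒜 (SetLike.GradedMul.mul_mem a.2 c.2)]
          rw [pow_add, mul_smul, smul_mul_assoc, mul_smul_comm])

/-- The subspace `S(φ, ψ)`: the largest graded subcoalgebra of `H` on which the linear functionals
`φ` and `ψ` agree (the sum of all of them; by `largestSubcoalgebra_mem` it is one of them). -/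
def largestSubcoalgebra [Ring H] [Bialgebra k H] (𝒜 : ℕ → Submodule k H) [GradedAlgebra 𝒜]
    (φ ψ : H →ₗ[k] k) : Submodule k H :=
  sSup {C | (∀ h ∈ C, ∀ n, (DirectSum.decompose 𝒜 h n : H) ∈ C) ∧ IsSubcoalgebra C ∧
    ∀ h ∈ C, φ h = ψ h}

theorem largestSubcoalgebra_mem [Ring H] [Bialgebra k H] (𝒜 : ℕ → Submodule k H)
    [GradedAlgebra 𝒜] (φ ψ : H →ₗ[k] k) :
    largestSubcoalgebra 𝒜 φ ψ ∈
      {C : Submodule k H | (∀ h ∈ C, ∀ n, (DirectSum.decompose 𝒜 h n : H) ∈ C) ∧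
        IsSubcoalgebra C ∧ ∀ h ∈ C, φ h = ψ h} := by
  refine ⟨fun h hh n => ?_, fun h hh => ?_, fun h hh => ?_⟩
  · let p : H →ₗ[k] H := (𝒜 n).subtype ∘ₗ DirectSum.component k ℕ _ n ∘ₗ
      (DirectSum.decomposeLinearEquiv 𝒜).toLinearMap
    have : largestSubcoalgebra 𝒜 φ ψ ≤ (largestSubcoalgebra 𝒜 φ ψ).comap p :=
      sSup_le fun C hC x hx => (le_sSup hC : C ≤ _) (hC.1 x hx n)
    exact this hh
  · have : largestSubcoalgebra 𝒜 φ ψ ≤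
        (tensorSub (largestSubcoalgebra 𝒜 φ ψ) (largestSubcoalgebra 𝒜 φ ψ)).comap
          (Coalgebra.comul (R := k)) :=
      sSup_le fun C hC x hx => tensorSub_mono (le_sSup hC) (le_sSup hC) (hC.2.1 x hx)
    exact this hh
  · have : largestSubcoalgebra 𝒜 φ ψ ≤ LinearMap.eqLocus φ ψ :=
      sSup_le fun C hC x hx => hC.2.2 x hx
    exact this hh

/-- For characters `φ` and `ψ`, the subspace `S(φ, ψ)` is a subalgebra. -/
def largestSub [Ring H] [Bialgebra k H] (𝒜 : ℕ → Submodule k H) [GradedAlgebra 𝒜]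
    (φ ψ : H →ₐ[k] k) : Subalgebra k H :=
  (largestSubcoalgebra 𝒜 φ.toLinearMap ψ.toLinearMap).toSubalgebra
    (by
      have hone : Submodule.span k {(1 : H)} ≤
          largestSubcoalgebra 𝒜 φ.toLinearMap ψ.toLinearMap := by
        refine le_sSup ⟨fun h hh n => ?_, fun h hh => ?_, fun h hh => ?_⟩ <;>
          obtain ⟨c, rfl⟩ := Submodule.mem_span_singleton.1 hh
        · rw [DirectSum.decompose_smul, DirectSum.smul_apply, Submodule.coe_smul]
          refine Submodule.smul_mem _ _ ?_
          rw [DirectSum.decompose_of_mem 𝒜 (SetLike.GradedOne.one_mem (A := 𝒜))]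
          by_cases h0 : n = 0
          · subst h0
            simp
          · rw [DirectSum.of_eq_of_ne _ _ _ h0]
            simp
        · rw [map_smul, Bialgebra.comul_one]
          exact Submodule.smul_mem _ _ (tmul_mem_tensorSub (Submodule.mem_span_singleton_self _)
            (Submodule.mem_span_singleton_self _))
        · simp
      exact hone (Submodule.mem_span_singleton_self _))
    (by
      intro x y hx hy
      obtain ⟨h1, h2, h3⟩ := largestSubcoalgebra_mem 𝒜 φ.toLinearMap ψ.toLinearMap
      set S := largestSubcoalgebra 𝒜 φ.toLinearMap ψ.toLinearMap with hS
      suffices h : S * S ≤ S from h (Submodule.mul_mem_mul hx hy)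
      refine le_sSup ⟨fun h hh n => ?_, fun h hh => ?_, fun h hh => ?_⟩
      · let p : H →ₗ[k] H := (𝒜 n).subtype ∘ₗ DirectSum.component k ℕ _ n ∘ₗ
          (DirectSum.decomposeLinearEquiv 𝒜).toLinearMap
        have : S * S ≤ (S * S).comap p := by
          refine Submodule.mul_le.2 fun a ha b hb => ?_
          change (DirectSum.decompose 𝒜 (a * b) n : H) ∈ S * S
          classical
          rw [DirectSum.decompose_mul, DirectSum.coe_mul_apply]
          exact Submodule.sum_mem _ fun i _ => Submodule.mul_mem_mul (h1 a ha _) (h1 b hb _)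
        exact this hh
      · have : S * S ≤ (tensorSub (S * S) (S * S)).comap (Coalgebra.comul (R := k)) := by
          refine Submodule.mul_le.2 fun a ha b hb => ?_
          rw [Submodule.mem_comap, Bialgebra.comul_mul]
          have key : tensorSub S S * tensorSub S S ≤ tensorSub (S * S) (S * S) := by
            refine Submodule.mul_le.2 fun s hs t ht => ?_
            have e1 : tensorSub S S ≤
                (tensorSub (S * S) (S * S)).comap (LinearMap.mulRight k t) := by
              refine tensorSub_le fun c hc d hd => ?_
              have e2 : tensorSub S S ≤
                  (tensorSub (S * S) (S * S)).comap (LinearMap.mulLeft k (c ⊗ₜ[k] d)) :=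
                tensorSub_le fun c' hc' d' hd' => by
                  simpa using tmul_mem_tensorSub (Submodule.mul_mem_mul hc hc')
                    (Submodule.mul_mem_mul hd hd')
              exact e2 ht
            exact e1 hs
          exact key (Submodule.mul_mem_mul (h2 a ha) (h2 b hb))
        exact this hh
      · have : S * S ≤ LinearMap.eqLocus φ.toLinearMap ψ.toLinearMap :=
          Submodule.mul_le.2 fun a ha b hb => by
            have ha' := h3 a ha
            have hb' := h3 b hb
            simp only [AlgHom.toLinearMap_apply] at ha' hb'
            simp [ha', hb']
        exact this hh)

/-! ### The bialgebra structure of a subalgebra which is a subcoalgebra -/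

theorem coassoc_of_injective {V W : Type*} [AddCommGroup V] [Module k V] [AddCommGroup W]
    [Module k W] (i : V →ₗ[k] W) (hi : Function.Injective i) (d : W →ₗ[k] W ⊗[k] W)
    (e : V →ₗ[k] V ⊗[k] V) (hde : ∀ v, TensorProduct.map i i (e v) = d (i v))
    (hd : TensorProduct.assoc k W W W ∘ₗ d.rTensor W ∘ₗ d = d.lTensor W ∘ₗ d) :
    TensorProduct.assoc k V V V ∘ₗ e.rTensor V ∘ₗ e = e.lTensor V ∘ₗ e := by
  have inj : Function.Injective (TensorProduct.map i (TensorProduct.map i i)) :=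
    TensorProduct.map_injective_of_flat_flat _ _ hi
      (TensorProduct.map_injective_of_flat_flat _ _ hi hi)
  have hde' : TensorProduct.map i i ∘ₗ e = d ∘ₗ i := LinearMap.ext hde
  have e0 : TensorProduct.map i (TensorProduct.map i i) ∘ₗ
      (TensorProduct.assoc k V V V).toLinearMap =
      (TensorProduct.assoc k W W W).toLinearMap ∘ₗ
        TensorProduct.map (TensorProduct.map i i) i :=
    TensorProduct.ext_threefold fun _ _ _ => rfl
  have e1 : TensorProduct.map (TensorProduct.map i i) i ∘ₗ e.rTensor V =
      d.rTensor W ∘ₗ TensorProduct.map i i := by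
    refine TensorProduct.ext' fun x y => ?_
    simp [hde]
  have e2 : TensorProduct.map i (TensorProduct.map i i) ∘ₗ e.lTensor V =
      d.lTensor W ∘ₗ TensorProduct.map i i := by
    refine TensorProduct.ext' fun x y => ?_
    simp [hde]
  ext v
  apply inj
  calc _ = (TensorProduct.map i (TensorProduct.map i i) ∘ₗ
        (TensorProduct.assoc k V V V).toLinearMap) (e.rTensor V (e v)) := rfl
    _ = TensorProduct.assoc k W W W
        ((TensorProduct.map (TensorProduct.map i i) i ∘ₗ e.rTensor V) (e v)) := by rw [e0]; rfl
    _ = TensorProduct.assoc k W W W (d.rTensor W (d (i v))) := by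
        rw [e1, LinearMap.comp_apply, hde]
    _ = d.lTensor W (d (i v)) := LinearMap.congr_fun hd (i v)
    _ = (TensorProduct.map i (TensorProduct.map i i) ∘ₗ e.lTensor V) (e v) := by
        rw [e2, LinearMap.comp_apply, hde]

section Restrict

variable [Ring H] [Bialgebra k H] (B : Subalgebra k H)

/-- The inclusion `B ⊗ B → H ⊗ H`, as a morphism of algebras. -/
def inclTensor : B ⊗[k] B →ₐ[k] H ⊗[k] H := Algebra.TensorProduct.map B.val B.val

theorem inclTensor_injective : Function.Injective (inclTensor B) := by
  have := TensorProduct.map_injective_of_flat_flat B.val.toLinearMap B.val.toLinearMap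
    Subtype.val_injective Subtype.val_injective
  exact this

/-- The restriction of the comultiplication of `H` to a subcoalgebra. -/
def restrictComul (hB : IsSubcoalgebra (Subalgebra.toSubmodule B)) : B →ₗ[k] B ⊗[k] B :=
  (LinearEquiv.ofInjective (inclTensor B).toLinearMap (inclTensor_injective B)).symm.toLinearMap ∘ₗ
    ((Coalgebra.comul (R := k)) ∘ₗ B.val.toLinearMap).codRestrict
      (LinearMap.range (inclTensor B).toLinearMap) (fun b => hB b b.2)

theorem inclTensor_restrictComul (hB : IsSubcoalgebra (Subalgebra.toSubmodule B)) (b : B) :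
    inclTensor B (restrictComul B hB b) = Coalgebra.comul (R := k) (b : H) := by
  have := LinearEquiv.apply_symm_apply
    (LinearEquiv.ofInjective (inclTensor B).toLinearMap (inclTensor_injective B))
    (((Coalgebra.comul (R := k)) ∘ₗ B.val.toLinearMap).codRestrict
      (LinearMap.range (inclTensor B).toLinearMap) (fun b => hB b b.2) b)
  exact congrArg Subtype.val this

/-- A subcoalgebra is a coalgebra. -/
abbrev restrictCoalgebra (hB : IsSubcoalgebra (Subalgebra.toSubmodule B)) : Coalgebra k B where
  comul := restrictComul B hB
  counit := (Coalgebra.counit (R := k)) ∘ₗ B.val.toLinearMap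
  coassoc := by
    refine coassoc_of_injective B.val.toLinearMap Subtype.val_injective
      (Coalgebra.comul (R := k)) (restrictComul B hB) (fun b => ?_) Coalgebra.coassoc
    exact inclTensor_restrictComul B hB b
  rTensor_counit_comp_comul := by
    have inj : Function.Injective (TensorProduct.map (LinearMap.id : k →ₗ[k] k)
        B.val.toLinearMap) :=
      TensorProduct.map_injective_of_flat_flat _ _ Function.injective_id Subtype.val_injective
    ext b
    apply inj
    have e : ∀ t : B ⊗[k] B, TensorProduct.map (LinearMap.id : k →ₗ[k] k) B.val.toLinearMap
        (((Coalgebra.counit (R := k)) ∘ₗ B.val.toLinearMap).rTensor B t) =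
        (Coalgebra.counit (R := k)).rTensor H (inclTensor B t) := by
      intro t
      induction t with
      | zero => simp
      | add x y hx hy => simp only [map_add, hx, hy]
      | tmul x y => simp [inclTensor]
    rw [LinearMap.comp_apply, e, inclTensor_restrictComul]
    simp
  lTensor_counit_comp_comul := by
    have inj : Function.Injective (TensorProduct.map B.val.toLinearMap
        (LinearMap.id : k →ₗ[k] k)) :=
      TensorProduct.map_injective_of_flat_flat _ _ Subtype.val_injective Function.injective_id
    ext b
    apply inj
    have e : ∀ t : B ⊗[k] B, TensorProduct.map B.val.toLinearMap (LinearMap.id : k →ₗ[k] k)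
        (((Coalgebra.counit (R := k)) ∘ₗ B.val.toLinearMap).lTensor B t) =
        (Coalgebra.counit (R := k)).lTensor H (inclTensor B t) := by
      intro t
      induction t with
      | zero => simp
      | add x y hx hy => simp only [map_add, hx, hy]
      | tmul x y => simp [inclTensor]
    rw [LinearMap.comp_apply, e, inclTensor_restrictComul]
    simp

/-- A subalgebra which is a subcoalgebra is a bialgebra. -/
abbrev restrictBialgebra (hB : IsSubcoalgebra (Subalgebra.toSubmodule B)) : Bialgebra k B :=
  letI := restrictCoalgebra B hB
  Bialgebra.mk' k B
    (by change Coalgebra.counit (R := k) ((1 : B) : H) = 1; simp)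
    (by intro a b; change Coalgebra.counit (R := k) ((a * b : B) : H) = _; simp; rfl)
    (by
      apply inclTensor_injective B
      change inclTensor B (restrictComul B hB 1) = _
      rw [inclTensor_restrictComul]
      simp)
    (by
      intro a b
      apply inclTensor_injective B
      change inclTensor B (restrictComul B hB (a * b)) =
        inclTensor B (restrictComul B hB a * restrictComul B hB b)
      rw [map_mul (inclTensor B), inclTensor_restrictComul, inclTensor_restrictComul,
        inclTensor_restrictComul, Subalgebra.coe_mul, Bialgebra.comul_mul])

end Restrict

/-! ### Antipodes -/

/-- The linear map `id - 1 ∘ ε`, as an element of the convolution algebra of `H`. -/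
def augProj (k : Type*) [Field k] (H : Type*) [Ring H] [Bialgebra k H] :
    WithConv (H →ₗ[k] H) :=
  toConv LinearMap.id - 1

/-- The coalgebra is conilpotent: each element is killed by almost all convolution powers
of `id - 1 ∘ ε`. -/
def IsConilpotent (k : Type*) [Field k] (H : Type*) [Ring H] [Bialgebra k H] : Prop :=
  ∀ h : H, ∃ N : ℕ, ∀ m, N ≤ m → (augProj k H ^ m) h = 0

theorem isConilpotent_restrict [Ring H] [Bialgebra k H] (hH : IsConilpotent k H)
    (B : Subalgebra k H) (hB : IsSubcoalgebra (Subalgebra.toSubmodule B)) :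
    letI := restrictBialgebra B hB
    IsConilpotent k B := by
  let _ := restrictBialgebra B hB
  have key : ∀ (m : ℕ) (b : B), (((augProj k B ^ m) b : B) : H) = (augProj k H ^ m) (b : H) := by
    intro m
    induction m with
    | zero =>
      intro b
      rfl
    | succ m ih =>
      intro b
      have e : ∀ t : B ⊗[k] B, ((LinearMap.mul' k B (TensorProduct.map
          (augProj k B ^ m).ofConv (augProj k B).ofConv t) : B) : H) =
          LinearMap.mul' k H (TensorProduct.map (augProj k H ^ m).ofConv (augProj k H).ofConv
            (inclTensor B t)) := by
        intro t
        induction t with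
        | zero => simp
        | add x y hx hy => simp only [map_add, Subalgebra.coe_add, hx, hy]
        | tmul x y =>
          have h2 : (((augProj k B) y : B) : H) = (augProj k H) (y : H) := rfl
          simp [inclTensor, ih, h2]
      rw [pow_succ, pow_succ, LinearMap.convMul_apply, LinearMap.convMul_apply, e]
      congr 2
      exact inclTensor_restrictComul B hB b
  intro b
  obtain ⟨N, hN⟩ := hH (b : H)
  exact ⟨N, fun m hm => Subtype.val_injective (by rw [key, hN m hm]; rfl)⟩

section Antipode

variable [Ring H] [Bialgebra k H]

/-- The partial sums of the series `∑ (-1)ᵐ (id - 1 ∘ ε)ᵐ`. -/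
def antipodePartial (k : Type*) [Field k] (H : Type*) [Ring H] [Bialgebra k H] (N : ℕ) :
    WithConv (H →ₗ[k] H) :=
  ∑ m ∈ Finset.range N, (-augProj k H) ^ m

theorem antipodePartial_stable {h : H} {N : ℕ} (hN : ∀ m, N ≤ m → (augProj k H ^ m) h = 0)
    {M : ℕ} (hM : N ≤ M) : antipodePartial k H M h = antipodePartial k H N h := by
  induction M, hM using Nat.le_induction with
  | base => rfl
  | succ M hM ih =>
    rw [antipodePartial, Finset.sum_range_succ]
    change antipodePartial k H M h + ((-augProj k H) ^ M) h = _
    rw [ih, neg_pow]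
    have : ((-1 : WithConv (H →ₗ[k] H)) ^ M * augProj k H ^ M) h = 0 := by
      rcases neg_one_pow_eq_or (WithConv (H →ₗ[k] H)) M with h1 | h1 <;> rw [h1]
      · rw [one_mul, hN M hM]
      · rw [neg_one_mul]
        change -((augProj k H ^ M) h) = 0
        rw [hN M hM, neg_zero]
    rw [this, add_zero]

/-- The sum `∑ (-1)ᵐ (id - 1 ∘ ε)ᵐ`, which is the antipode of a conilpotent bialgebra. -/
def antipodeSeries (hH : IsConilpotent k H) : H →ₗ[k] H where
  toFun h := antipodePartial k H (hH h).choose h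
  map_add' x y := by
    have hx := antipodePartial_stable (hH x).choose_spec
      ((le_max_left _ (hH y).choose).trans (le_max_left _ (hH (x + y)).choose))
    have hy := antipodePartial_stable (hH y).choose_spec
      ((le_max_right (hH x).choose _).trans (le_max_left _ (hH (x + y)).choose))
    have hxy := antipodePartial_stable (hH (x + y)).choose_spec
      (le_max_right (max (hH x).choose (hH y).choose) _)
    rw [← hx, ← hy, ← hxy]
    exact map_add (antipodePartial k H _).ofConv x y
  map_smul' c x := by
    have hx := antipodePartial_stable (hH x).choose_spec (le_max_left _ (hH (c • x)).choose)
    have hcx := antipodePartial_stable (hH (c • x)).choose_spec (le_max_right (hH x).choose _)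
    rw [RingHom.id_apply, ← hx, ← hcx]
    exact map_smul (antipodePartial k H _).ofConv c x

theorem antipodeSeries_eq (hH : IsConilpotent k H) (h : H) :
    ∃ N, ∀ M, N ≤ M → antipodeSeries hH h = antipodePartial k H M h :=
  ⟨(hH h).choose, fun _ hM => (antipodePartial_stable (hH h).choose_spec hM).symm⟩

theorem antipodePartial_mul_id (N : ℕ) :
    antipodePartial k H N * toConv LinearMap.id = 1 - (-augProj k H) ^ N := by
  have : (toConv LinearMap.id : WithConv (H →ₗ[k] H)) = 1 - (-augProj k H) := by
    simp [augProj]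
  rw [this]
  exact geom_sum_mul_neg _ _

theorem id_mul_antipodePartial (N : ℕ) :
    toConv LinearMap.id * antipodePartial k H N = 1 - (-augProj k H) ^ N := by
  have : (toConv LinearMap.id : WithConv (H →ₗ[k] H)) = 1 - (-augProj k H) := by
    simp [augProj]
  rw [this]
  exact mul_neg_geom_sum _ _

theorem one_sub_neg_pow_apply (hH : IsConilpotent k H) (h : H) :
    ∃ N, ∀ M, N ≤ M → (1 - (-augProj k H) ^ M : WithConv (H →ₗ[k] H)) h =
      (1 : WithConv (H →ₗ[k] H)) h := by
  obtain ⟨N, hN⟩ := hH h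
  refine ⟨N, fun M hM => ?_⟩
  have h1 := antipodePartial_stable hN hM
  have h2 := antipodePartial_stable hN (hM.trans (Nat.le_succ M))
  rw [antipodePartial, Finset.sum_range_succ] at h2
  change antipodePartial k H M h + ((-augProj k H) ^ M) h = _ at h2
  change (1 : WithConv (H →ₗ[k] H)) h - ((-augProj k H) ^ M) h = _
  rw [← h1] at h2
  rw [add_eq_left.1 h2, sub_zero]

/-- A conilpotent bialgebra is a Hopf algebra. -/
abbrev hopfOfConilpotent (hH : IsConilpotent k H) : HopfAlgebra k H :=
  HopfAlgebra.ofConvInverse (antipodeSeries hH)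
    (by
      ext h
      choose N hN using antipodeSeries_eq hH
      obtain ⟨N', hN'⟩ := one_sub_neg_pow_apply hH h
      let r := Coalgebra.Repr.arbitrary k h
      let M := max N' (r.index.sup fun i => N (r.left i))
      change (toConv (antipodeSeries hH) * toConv LinearMap.id : WithConv (H →ₗ[k] H)) h =
        (1 : WithConv (H →ₗ[k] H)) h
      rw [← hN' M (le_max_left _ _), ← antipodePartial_mul_id, r.convMul_apply, r.convMul_apply]
      refine Finset.sum_congr rfl fun i hi => ?_
      congr 1
      exact hN _ M ((Finset.le_sup (f := fun i => N (r.left i)) hi).trans (le_max_right _ _)))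
    (by
      ext h
      choose N hN using antipodeSeries_eq hH
      obtain ⟨N', hN'⟩ := one_sub_neg_pow_apply hH h
      let r := Coalgebra.Repr.arbitrary k h
      let M := max N' (r.index.sup fun i => N (r.right i))
      change (toConv LinearMap.id * toConv (antipodeSeries hH) : WithConv (H →ₗ[k] H)) h =
        (1 : WithConv (H →ₗ[k] H)) h
      rw [← hN' M (le_max_left _ _), ← id_mul_antipodePartial, r.convMul_apply, r.convMul_apply]
      refine Finset.sum_congr rfl fun i hi => ?_
      congr 1
      exact hN _ M ((Finset.le_sup (f := fun i => N (r.right i)) hi).trans (le_max_right _ _)))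

end Antipode

end General

/-! ### Compositions and exponent vectors -/

/-- The list of nonzero exponents of the monomial `x ^ m` in the variables `x₀, x₁, x₂, …`, in
increasing order of the variables: for `m = x_{i₁}^{a₁} ⋯ x_{i_r}^{a_r}` with `i₁ < ⋯ < i_r` and
all `a_j > 0`, this is the composition `(a₁, …, a_r)`. -/
def expWord (m : ℕ →₀ ℕ) : List ℕ+ :=
  (m.support.sort (· ≤ ·)).map fun i => (m i).toPNat'

/-- The word of a list of exponents. -/
def strip (l : List ℕ) : List ℕ+ := (l.filter (· ≠ 0)).map Nat.toPNat'

theorem expWord_toFinsupp (l : List ℕ) : expWord l.toFinsupp = strip l := by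
  have hs : l.toFinsupp.support.sort (· ≤ ·) =
      (List.range l.length).filter (fun i => l.getD i 0 ≠ 0) := by
    refine List.Perm.eq_of_pairwise' (r := (· ≤ ·)) ?_ ?_ ?_
    · exact Finset.pairwise_sort _ _
    · exact (List.pairwise_le_range).filter _
    · refine (List.perm_ext_iff_of_nodup (Finset.sort_nodup _ _)
        ((List.nodup_range).filter _)).2 fun a => ?_
      simp [List.toFinsupp_support]
  rw [expWord, hs, strip]
  have hl : l = (List.range l.length).map (fun i => l.getD i 0) := by
    apply List.ext_getElem
    · simp
    · intro i h1 h2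
      simp [h1]
  conv_rhs => rw [hl, List.filter_map, List.map_map]
  rfl

theorem exists_toFinsupp (m : ℕ →₀ ℕ) : ∃ l : List ℕ, l.toFinsupp = m := by
  refine ⟨(List.range (m.support.sup id + 1)).map m, ?_⟩
  ext i
  rw [List.toFinsupp_apply]
  by_cases h : i < m.support.sup id + 1
  · rw [List.getD_eq_getElem _ _ (by simpa using h)]
    simp
  · rw [List.getD_eq_default _ _ (by simp; omega)]
    by_contra h'
    have : i ∈ m.support := by simpa using Ne.symm h'
    have := Finset.le_sup (f := id) this
    simp at this
    omega

/-- The exponent vector `(a₁, …, a_r, 0, 0, …)` of a composition. -/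
def wordExp (w : List ℕ+) : ℕ →₀ ℕ := (w.map (fun a : ℕ+ => (a : ℕ))).toFinsupp

theorem strip_coe (w : List ℕ+) : strip (w.map (fun a : ℕ+ => (a : ℕ))) = w := by
  induction w with
  | nil => rfl
  | cons a w ih =>
    simp only [strip, List.map_cons] at ih ⊢
    rw [List.filter_cons_of_pos (by simp), List.map_cons, ih]
    simp

theorem expWord_wordExp (w : List ℕ+) : expWord (wordExp w) = w := by
  rw [wordExp, expWord_toFinsupp, strip_coe]

theorem strip_append (l l' : List ℕ) : strip (l ++ l') = strip l ++ strip l' := by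
  simp [strip]

theorem strip_cons_zero (l : List ℕ) : strip (0 :: l) = strip l := by
  simp [strip]

theorem strip_cons_pos {a : ℕ} (ha : a ≠ 0) (l : List ℕ) :
    strip (a :: l) = a.toPNat' :: strip l := by
  simp [strip, ha]

/-- Sum over all ways of writing a list of exponents as a sum of two such lists. -/
def splitSum {R : Type*} [AddCommMonoid R] : List ℕ → (List ℕ → List ℕ → R) → R
  | [], F => F [] []
  | a :: l, F => ∑ p ∈ Finset.HasAntidiagonal.antidiagonal a, splitSum l fun s t => F (p.1 :: s) (p.2 :: t)

/-- the exponent vector `(a, m₀, m₁, …)`. -/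
def consExp (a : ℕ) (m : ℕ →₀ ℕ) : ℕ →₀ ℕ :=
  Finsupp.single 0 a + m.embDomain (addRightEmbedding 1)

theorem consExp_zero' (a : ℕ) (m : ℕ →₀ ℕ) : consExp a m 0 = a := by
  simp only [consExp, Finsupp.add_apply, Finsupp.single_eq_same]
  rw [Finsupp.embDomain_of_notMem_range]
  · rfl
  · simp

theorem consExp_succ (a : ℕ) (m : ℕ →₀ ℕ) (i : ℕ) : consExp a m (i + 1) = m i := by
  simp only [consExp, Finsupp.add_apply]
  have := Finsupp.embDomain_apply_self (addRightEmbedding 1) m i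
  simp only [addRightEmbedding_apply] at this
  rw [this]
  simp

theorem consExp_toFinsupp (a : ℕ) (l : List ℕ) :
    (a :: l).toFinsupp = consExp a l.toFinsupp := by
  rw [List.toFinsupp_cons_eq_single_add_embDomain]
  rfl

theorem sum_antidiagonal_consExp {R : Type*} [AddCommMonoid R] (a : ℕ) (m : ℕ →₀ ℕ)
    (G : (ℕ →₀ ℕ) → (ℕ →₀ ℕ) → R) :
    ∑ p ∈ Finset.HasAntidiagonal.antidiagonal (consExp a m), G p.1 p.2 =
      ∑ q ∈ Finset.HasAntidiagonal.antidiagonal a, ∑ r ∈ Finset.HasAntidiagonal.antidiagonal m, G (consExp q.1 r.1) (consExp q.2 r.2) := by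
  rw [← Finset.sum_product']
  symm
  have hinj : Function.Injective (fun i : ℕ => i + 1) := Nat.succ_injective
  let tail : (ℕ →₀ ℕ) → (ℕ →₀ ℕ) := fun m => m.comapDomain (fun i => i + 1) hinj.injOn
  have htail : ∀ m i, tail m i = m (i + 1) := fun m i => rfl
  have hcons : ∀ m, consExp (m 0) (tail m) = m := by
    intro m
    ext i
    cases i with
    | zero => exact consExp_zero' _ _
    | succ i => rw [consExp_succ, htail]
  refine Finset.sum_bij' (fun x _ => (consExp x.1.1 x.2.1, consExp x.1.2 x.2.2))
    (fun p _ => ((p.1 0, p.2 0), (tail p.1, tail p.2))) ?_ ?_ ?_ ?_ ?_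
  · rintro ⟨q, r⟩ h
    simp only [Finset.mem_product, Finset.HasAntidiagonal.mem_antidiagonal] at h ⊢
    ext i
    cases i with
    | zero => simp [consExp_zero', h.1]
    | succ i => simp [consExp_succ, ← h.2]
  · rintro ⟨p, q⟩ h
    simp only [Finset.mem_product, Finset.HasAntidiagonal.mem_antidiagonal] at h ⊢
    refine ⟨?_, ?_⟩
    · have := DFunLike.congr_fun h 0
      simpa [consExp_zero'] using this
    · ext i
      have := DFunLike.congr_fun h (i + 1)
      simpa [consExp_succ, htail] using this
  · rintro ⟨q, r⟩ _
    have h1 : ∀ a m, tail (consExp a m) = m := fun a m => by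
      ext i
      rw [htail, consExp_succ]
    simp [consExp_zero', h1]
  · rintro ⟨p, q⟩ _
    simp [hcons]
  · rintro ⟨q, r⟩ _
    rfl

theorem sum_antidiagonal_toFinsupp {R : Type*} [AddCommMonoid R] (l : List ℕ)
    (G : (ℕ →₀ ℕ) → (ℕ →₀ ℕ) → R) :
    ∑ p ∈ Finset.HasAntidiagonal.antidiagonal l.toFinsupp, G p.1 p.2 =
      splitSum l fun s t => G s.toFinsupp t.toFinsupp := by
  induction l generalizing G with
  | nil => simp [splitSum]
  | cons a l ih =>
    rw [consExp_toFinsupp, sum_antidiagonal_consExp, splitSum]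
    refine Finset.sum_congr rfl fun q _ => ?_
    rw [ih fun s t => G (consExp q.1 s) (consExp q.2 t)]
    simp only [consExp_toFinsupp]

theorem splitSum_strip {R : Type*} [AddCommMonoid R] (l : List ℕ)
    (F : List ℕ+ → List ℕ+ → R) :
    splitSum l (fun s t => F (strip s) (strip t)) =
      splitSum ((strip l).map (fun a : ℕ+ => (a : ℕ))) (fun s t => F (strip s) (strip t)) := by
  induction l generalizing F with
  | nil => rfl
  | cons a l ih =>
    have hp : ∀ (p : ℕ), ∃ g : List ℕ+ → List ℕ+, ∀ s, strip (p :: s) = g (strip s) := by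
      intro p
      by_cases h : p = 0
      · subst h
        exact ⟨id, fun s => strip_cons_zero s⟩
      · exact ⟨fun s => p.toPNat' :: s, fun s => strip_cons_pos h s⟩
    choose g hg using hp
    by_cases ha : a = 0
    · subst ha
      rw [strip_cons_zero, ← ih, splitSum]
      simp [strip_cons_zero]
    · rw [strip_cons_pos ha, List.map_cons]
      have : ((a.toPNat' : ℕ+) : ℕ) = a := by simp; omega
      rw [this, splitSum, splitSum]
      refine Finset.sum_congr rfl fun q _ => ?_
      simp only [hg]
      exact ih fun s t => F (g q.1 s) (g q.2 t)

theorem splitSum_append {R : Type*} [AddCommMonoid R] (u v : List ℕ)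
    (F : List ℕ → List ℕ → R) :
    splitSum (u ++ v) F =
      splitSum u fun s t => splitSum v fun s' t' => F (s ++ s') (t ++ t') := by
  induction u generalizing F with
  | nil => rfl
  | cons a u ih =>
    simp only [List.cons_append, splitSum, ih]

theorem splitSum_mul {R : Type*} [CommSemiring R] (u : List ℕ) (F : List ℕ → List ℕ → R) (c : R) :
    splitSum u F * c = splitSum u fun s t => F s t * c := by
  induction u generalizing F with
  | nil => rfl
  | cons a u ih => simp only [splitSum, Finset.sum_mul, ih]

theorem splitSum_add {R : Type*} [AddCommMonoid R] (u : List ℕ) (F G : List ℕ → List ℕ → R) :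
    splitSum u (fun s t => F s t + G s t) = splitSum u F + splitSum u G := by
  induction u generalizing F G with
  | nil => rfl
  | cons a u ih => simp only [splitSum, Finset.sum_add_distrib, ih]

theorem splitSum_zero {R : Type*} [AddCommMonoid R] (u : List ℕ) :
    splitSum u (fun _ _ => (0 : R)) = 0 := by
  induction u with
  | nil => rfl
  | cons a u ih => simp only [splitSum, ih, Finset.sum_const_zero]

theorem exists_of_splitSum_ne_zero {R : Type*} [AddCommMonoid R] (u : List ℕ)
    (F : List ℕ → List ℕ → R) (h : splitSum u F ≠ 0) :
    ∃ s t, s.sum + t.sum = u.sum ∧ F s t ≠ 0 := by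
  induction u generalizing F with
  | nil => exact ⟨[], [], rfl, h⟩
  | cons a u ih =>
    obtain ⟨q, hq, hq'⟩ := Finset.exists_ne_zero_of_sum_ne_zero h
    obtain ⟨s, t, hst, hF⟩ := ih _ hq'
    refine ⟨q.1 :: s, q.2 :: t, ?_, hF⟩
    have := Finset.HasAntidiagonal.mem_antidiagonal.1 hq
    simp only [List.sum_cons]
    omega

theorem splitSum_mul_splitSum {R : Type*} [CommSemiring R] (u v : List ℕ)
    (F G : List ℕ → List ℕ → R) :
    splitSum u F * splitSum v G =
      splitSum u fun s t => splitSum v fun s' t' => F s t * G s' t' := by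
  rw [splitSum_mul]
  congr 1
  ext s t
  rw [mul_comm, splitSum_mul]
  simp only [mul_comm]

/-- The sum `|α|` of the parts of a composition. -/
def wt (w : List ℕ+) : ℕ := (w.map (fun a : ℕ+ => (a : ℕ))).sum

theorem wt_append (u v : List ℕ+) : wt (u ++ v) = wt u + wt v := by
  simp [wt]

theorem wt_strip (l : List ℕ) : wt (strip l) = l.sum := by
  induction l with
  | nil => rfl
  | cons a l ih =>
    by_cases ha : a = 0
    · subst ha
      rw [strip_cons_zero, ih]
      simp
    · rw [strip_cons_pos ha, List.sum_cons, ← ih]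
      simp only [wt, List.map_cons, List.sum_cons, Nat.toPNat'_coe]
      simp
      omega

theorem finite_words (D : ℕ) : {w : List ℕ+ | wt w ≤ D}.Finite := by
  induction D using Nat.strong_induction_on with
  | _ D ih =>
    have : {w : List ℕ+ | wt w ≤ D} ⊆
        insert [] (⋃ a ∈ Finset.range (D + 1), ⋃ (_ : 0 < a),
          (List.cons a.toPNat') '' {w : List ℕ+ | wt w ≤ D - a}) := by
      rintro (_ | ⟨a, w⟩) hw
      · simp
      · simp only [wt, List.map_cons, List.sum_cons, Set.mem_ofPred_eq] at hw
        right
        simp only [Set.mem_iUnion]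
        refine ⟨a, by simp; omega, a.pos, w, ?_, ?_⟩
        · simp [wt]; omega
        · simp
    refine Set.Finite.subset (Set.Finite.insert _ ?_) this
    refine Set.Finite.biUnion (Finset.finite_toSet _) fun a ha => ?_
    refine Set.finite_iUnion fun h => Set.Finite.image _ (ih _ ?_)
    simp at ha
    omega


/-! ### Deconcatenation coproducts -/

section Deconcat

variable {k A V : Type*} [Field k] [AddCommGroup V] [Module k V] (b : Module.Basis (List A) k V)
  (d : V →ₗ[k] V ⊗[k] V)

theorem tensorProduct_repr_tmul' {ι κ W : Type*} [AddCommGroup W] [Module k W]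
    (b : Module.Basis ι k V) (c : Module.Basis κ k W) (f : V) (g : W) (u : ι) (v : κ) :
    (b.tensorProduct c).repr (f ⊗ₜ g) (u, v) = b.repr f u * c.repr g v := by
  simp [mul_comm]

theorem deconcat_coassoc (hd : ∀ f u v, (b.tensorProduct b).repr (d f) (u, v) =
      b.repr f (u ++ v)) :
    TensorProduct.assoc k V V V ∘ₗ d.rTensor V ∘ₗ d = d.lTensor V ∘ₗ d := by
  ext f
  apply (b.tensorProduct (b.tensorProduct b)).ext_elem
  rintro ⟨u, v, w⟩
  have h1 : ∀ t : V ⊗[k] V, (b.tensorProduct (b.tensorProduct b)).repr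
      (TensorProduct.assoc k V V V (d.rTensor V t)) (u, v, w) =
      (b.tensorProduct b).repr t (u ++ v, w) := by
    intro t
    induction t with
    | zero => simp
    | add x y hx hy =>
      rw [map_add, map_add, map_add, Finsupp.add_apply, hx, hy, map_add, Finsupp.add_apply]
    | tmul x y =>
      rw [LinearMap.rTensor_tmul, tensorProduct_repr_tmul', ← hd]
      generalize d x = s
      induction s with
      | zero => simp
      | add x y hx hy =>
        rw [TensorProduct.add_tmul, map_add, map_add, Finsupp.add_apply, hx, hy, map_add,
          Finsupp.add_apply, add_mul]
      | tmul a c =>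
        rw [TensorProduct.assoc_tmul, tensorProduct_repr_tmul', tensorProduct_repr_tmul',
          tensorProduct_repr_tmul', mul_assoc]
  have h2 : ∀ t : V ⊗[k] V, (b.tensorProduct (b.tensorProduct b)).repr
      (d.lTensor V t) (u, v, w) = (b.tensorProduct b).repr t (u, v ++ w) := by
    intro t
    induction t with
    | zero => simp
    | add x y hx hy =>
      rw [map_add, map_add, Finsupp.add_apply, hx, hy, map_add, Finsupp.add_apply]
    | tmul x y =>
      rw [LinearMap.lTensor_tmul, tensorProduct_repr_tmul', tensorProduct_repr_tmul', hd]
  simp only [LinearMap.comp_apply, LinearEquiv.coe_coe]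
  rw [h1, h2, hd, hd, List.append_assoc]

theorem deconcat_rTensor_counit (hd : ∀ f u v, (b.tensorProduct b).repr (d f) (u, v) =
      b.repr f (u ++ v)) (e : V →ₗ[k] k) (he : ∀ f, e f = b.repr f []) :
    e.rTensor V ∘ₗ d = TensorProduct.mk k k V 1 := by
  ext f
  apply (TensorProduct.lid k V).injective
  apply b.ext_elem
  intro w
  have h : ∀ t : V ⊗[k] V, b.repr (TensorProduct.lid k V (e.rTensor V t)) w =
      (b.tensorProduct b).repr t ([], w) := by
    intro t
    induction t with
    | zero => simp
    | add x y hx hy =>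
      rw [map_add, map_add, map_add, Finsupp.add_apply, hx, hy, map_add, Finsupp.add_apply]
    | tmul x y =>
      rw [tensorProduct_repr_tmul', ← he]
      simp
  rw [LinearMap.comp_apply, h, hd]
  simp

theorem deconcat_lTensor_counit (hd : ∀ f u v, (b.tensorProduct b).repr (d f) (u, v) =
      b.repr f (u ++ v)) (e : V →ₗ[k] k) (he : ∀ f, e f = b.repr f []) :
    e.lTensor V ∘ₗ d = (TensorProduct.mk k V k).flip 1 := by
  ext f
  apply (TensorProduct.rid k V).injective
  apply b.ext_elem
  intro w
  have h : ∀ t : V ⊗[k] V, b.repr (TensorProduct.rid k V (e.lTensor V t)) w =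
      (b.tensorProduct b).repr t (w, []) := by
    intro t
    induction t with
    | zero => simp
    | add x y hx hy =>
      rw [map_add, map_add, map_add, Finsupp.add_apply, hx, hy, map_add, Finsupp.add_apply]
    | tmul x y =>
      rw [tensorProduct_repr_tmul', ← he]
      simp [mul_comm]
  rw [LinearMap.comp_apply, h, hd]
  simp

end Deconcat

/-! ### Quasi-symmetric functions -/

section QSymDef

variable (k : Type*) [Field k]

/-- The monomial quasi-symmetric function `M_α = ∑_{i₁ < ⋯ < i_r} x_{i₁}^{a₁} ⋯ x_{i_r}^{a_r}`,
a formal power series in the variables `x₀, x₁, x₂, …`, for `α = (a₁, …, a_r)`. -/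
def monomialQSym (w : List ℕ+) : MvPowerSeries ℕ k :=
  fun m => if expWord m = w then 1 else 0

theorem coeff_monomialQSym (w : List ℕ+) (m : ℕ →₀ ℕ) :
    MvPowerSeries.coeff m (monomialQSym k w) = if expWord m = w then 1 else 0 := rfl

theorem coeff_linearCombination (c : List ℕ+ →₀ k) (m : ℕ →₀ ℕ) :
    MvPowerSeries.coeff m (Finsupp.linearCombination k (monomialQSym k) c) = c (expWord m) := by
  rw [Finsupp.linearCombination_apply, Finsupp.sum, map_sum]
  simp [coeff_monomialQSym]

theorem mem_span_monomialQSym (f : MvPowerSeries ℕ k) :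
    f ∈ Submodule.span k (Set.range (monomialQSym k)) ↔
      ∃ c : List ℕ+ →₀ k, ∀ m, MvPowerSeries.coeff m f = c (expWord m) := by
  rw [Finsupp.mem_span_range_iff_exists_finsupp]
  constructor
  · rintro ⟨c, rfl⟩
    exact ⟨c, fun m => coeff_linearCombination k c m⟩
  · rintro ⟨c, hc⟩
    refine ⟨c, ?_⟩
    ext m
    rw [hc]
    exact coeff_linearCombination k c m

theorem coeff_mul_of_word {f g : MvPowerSeries ℕ k} {c d : List ℕ+ → k}
    (hf : ∀ m, MvPowerSeries.coeff m f = c (expWord m))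
    (hg : ∀ m, MvPowerSeries.coeff m g = d (expWord m)) (m : ℕ →₀ ℕ) :
    MvPowerSeries.coeff m (f * g) =
      splitSum ((expWord m).map (fun a : ℕ+ => (a : ℕ)))
        (fun s t => c (strip s) * d (strip t)) := by
  classical
  obtain ⟨l, rfl⟩ := exists_toFinsupp m
  rw [MvPowerSeries.coeff_mul]
  simp only [hf, hg]
  refine (sum_antidiagonal_toFinsupp l fun p q => c (expWord p) * d (expWord q)).trans ?_
  simp only [expWord_toFinsupp]
  exact splitSum_strip l fun s t => c s * d t

/-- The algebra of quasi-symmetric functions: the linear span of the `M_α`, a subalgebra of the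
algebra of formal power series. -/
def QSym : Subalgebra k (MvPowerSeries ℕ k) :=
  (Submodule.span k (Set.range (monomialQSym k))).toSubalgebra
    (by
      refine Submodule.subset_span ⟨[], ?_⟩
      classical
      ext m
      rw [coeff_monomialQSym, MvPowerSeries.coeff_one]
      congr 1
      simp only [eq_iff_iff, expWord, List.map_eq_nil_iff]
      rw [← List.length_eq_zero_iff, Finset.length_sort]
      simp)
    (by
      intro f g hf hg
      obtain ⟨c, hc⟩ := (mem_span_monomialQSym k f).1 hf
      obtain ⟨d, hd⟩ := (mem_span_monomialQSym k g).1 hg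
      rw [mem_span_monomialQSym]
      let E : List ℕ+ → k := fun w => splitSum (w.map (fun a : ℕ+ => (a : ℕ)))
        (fun s t => c (strip s) * d (strip t))
      have hE : (Function.support E).Finite := by
        refine (finite_words (c.support.sup wt + d.support.sup wt)).subset fun w hw => ?_
        obtain ⟨s, t, hst, hF⟩ := exists_of_splitSum_ne_zero _ _ hw
        have h1 : strip s ∈ c.support := by simpa using left_ne_zero_of_mul hF
        have h2 : strip t ∈ d.support := by simpa using right_ne_zero_of_mul hF
        have h1 := Finset.le_sup (f := wt) h1
        have h2 := Finset.le_sup (f := wt) h2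
        rw [wt_strip] at h1 h2
        change wt w ≤ _
        change _ = wt w at hst
        omega
      exact ⟨Finsupp.ofSupportFinite E hE, fun m => coeff_mul_of_word k hc hd m⟩)

theorem mem_QSym (f : MvPowerSeries ℕ k) :
    f ∈ QSym k ↔ ∃ c : List ℕ+ →₀ k, ∀ m, MvPowerSeries.coeff m f = c (expWord m) :=
  mem_span_monomialQSym k f

namespace QSym

/-- The map sending a finite family of coefficients `c` to `∑ c_α M_α`. -/
def ofCoeffs : (List ℕ+ →₀ k) →ₗ[k] QSym k :=
  (Finsupp.linearCombination k (monomialQSym k)).codRestrict (Subalgebra.toSubmodule (QSym k))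
    (fun c => (mem_QSym k _).2 ⟨c, coeff_linearCombination k c⟩)

theorem ofCoeffs_bijective : Function.Bijective (ofCoeffs k) := by
  constructor
  · intro c d h
    ext w
    have h' := congrArg (fun f : QSym k => MvPowerSeries.coeff (wordExp w) (f : MvPowerSeries ℕ k)) h
    change MvPowerSeries.coeff (wordExp w) (Finsupp.linearCombination k (monomialQSym k) c) =
      MvPowerSeries.coeff (wordExp w) (Finsupp.linearCombination k (monomialQSym k) d) at h'
    rwa [coeff_linearCombination, coeff_linearCombination, expWord_wordExp] at h'
  · rintro ⟨f, hf⟩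
    obtain ⟨c, hc⟩ := (mem_QSym k f).1 hf
    refine ⟨c, Subtype.ext ?_⟩
    ext m
    rw [hc]
    exact coeff_linearCombination k c m

/-- The basis `M_α` of `QSym`, indexed by all compositions. -/
def M : Module.Basis (List ℕ+) k (QSym k) :=
  Module.Basis.ofRepr (LinearEquiv.ofBijective (ofCoeffs k) (ofCoeffs_bijective k)).symm

theorem coe_M (w : List ℕ+) : (M k w : MvPowerSeries ℕ k) = monomialQSym k w := by
  change Finsupp.linearCombination k (monomialQSym k) (Finsupp.single w 1) = _
  simp

theorem coeff_eq_repr (f : QSym k) (m : ℕ →₀ ℕ) :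
    MvPowerSeries.coeff m (f : MvPowerSeries ℕ k) = (M k).repr f (expWord m) := by
  have h : ofCoeffs k ((M k).repr f) = f := (M k).repr.symm_apply_apply f
  conv_lhs => rw [← h]
  exact coeff_linearCombination k _ m

theorem repr_mul (f g : QSym k) (w : List ℕ+) :
    (M k).repr (f * g) w = splitSum (w.map (fun a : ℕ+ => (a : ℕ)))
      (fun s t => (M k).repr f (strip s) * (M k).repr g (strip t)) := by
  have := coeff_mul_of_word k (coeff_eq_repr k f) (coeff_eq_repr k g) (wordExp w)
  rwa [← Subalgebra.coe_mul, coeff_eq_repr, expWord_wordExp] at this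

theorem M_nil : M k [] = 1 := by
  apply Subtype.ext
  rw [coe_M]
  classical
  ext m
  rw [coeff_monomialQSym, Subalgebra.coe_one, MvPowerSeries.coeff_one]
  congr 1
  simp only [eq_iff_iff, expWord, List.map_eq_nil_iff]
  rw [← List.length_eq_zero_iff, Finset.length_sort]
  simp

/-- The comultiplication `Δ(M_α) = ∑_{α = βγ} M_β ⊗ M_γ`. -/
def comul : QSym k →ₗ[k] QSym k ⊗[k] QSym k :=
  (M k).constr k fun w =>
    ∑ i ∈ Finset.range (w.length + 1), M k (w.take i) ⊗ₜ[k] M k (w.drop i)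

/-- The counit: the constant term. -/
def counit : QSym k →ₐ[k] k where
  __ := (MvPowerSeries.constantCoeff (σ := ℕ) (R := k)).comp (QSym k).val.toRingHom
  commutes' r := by
    change MvPowerSeries.constantCoeff (algebraMap k (MvPowerSeries ℕ k) r) = r
    simp [MvPowerSeries.algebraMap_apply]

theorem counit_apply (f : QSym k) : counit k f = (M k).repr f [] := by
  have : MvPowerSeries.coeff (0 : ℕ →₀ ℕ) (f : MvPowerSeries ℕ k) = _ := coeff_eq_repr k f 0
  have h0 : expWord 0 = [] := by simp [expWord]
  rw [h0] at this
  exact this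

/-- The basis `M_α ⊗ M_β`. -/
def MM : Module.Basis (List ℕ+ × List ℕ+) k (QSym k ⊗[k] QSym k) := (M k).tensorProduct (M k)

theorem MM_repr_tmul (f g : QSym k) (u v : List ℕ+) :
    (MM k).repr (f ⊗ₜ g) (u, v) = (M k).repr f u * (M k).repr g v := by
  simp [MM, mul_comm]

theorem repr_comul (f : QSym k) (u v : List ℕ+) :
    (MM k).repr (comul k f) (u, v) = (M k).repr f (u ++ v) := by
  have : (Finsupp.lapply (u, v) ∘ₗ (MM k).repr.toLinearMap ∘ₗ comul k) =
      Finsupp.lapply (u ++ v) ∘ₗ (M k).repr.toLinearMap := by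
    refine (M k).ext fun w => ?_
    simp only [LinearMap.comp_apply, comul, Module.Basis.constr_basis, LinearEquiv.coe_coe,
      map_sum, Finsupp.lapply_apply, MM_repr_tmul, Module.Basis.repr_self]
    by_cases h : w = u ++ v
    · subst h
      rw [Finset.sum_eq_single u.length]
      · simp
      · intro i hi hne
        rw [Finsupp.single_apply, if_neg, zero_mul]
        intro h
        have := congrArg List.length h
        simp at this hi
        omega
      · intro h
        simp at h
    · rw [Finsupp.single_apply, if_neg h]
      refine Finset.sum_eq_zero fun i _ => ?_
      by_contra h0
      have h1 := left_ne_zero_of_mul h0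
      have h2 := right_ne_zero_of_mul h0
      rw [Finsupp.single_apply] at h1 h2
      simp only [ne_eq, ite_eq_right_iff, one_ne_zero, imp_false, not_not] at h1 h2
      exact h (by rw [← h1, ← h2, List.take_append_drop])
  exact LinearMap.congr_fun this f

theorem MM_repr_mul (s t : QSym k ⊗[k] QSym k) (u v : List ℕ+) :
    (MM k).repr (s * t) (u, v) =
      splitSum (u.map (fun a : ℕ+ => (a : ℕ))) fun a b =>
        splitSum (v.map (fun a : ℕ+ => (a : ℕ))) fun a' b' =>
          (MM k).repr s (strip a, strip a') * (MM k).repr t (strip b, strip b') := by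
  induction s with
  | zero => simp [splitSum_zero]
  | add x y hx hy =>
    rw [add_mul, map_add, Finsupp.add_apply, hx, hy]
    simp only [map_add, Finsupp.add_apply, add_mul, splitSum_add]
  | tmul f g =>
    induction t with
    | zero => simp [splitSum_zero]
    | add x y hx hy =>
      rw [mul_add, map_add, Finsupp.add_apply, hx, hy]
      simp only [map_add, Finsupp.add_apply, mul_add, splitSum_add]
    | tmul f' g' =>
      rw [Algebra.TensorProduct.tmul_mul_tmul, MM_repr_tmul, repr_mul, repr_mul,
        splitSum_mul_splitSum]
      simp only [MM_repr_tmul, mul_mul_mul_comm]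

theorem comul_mul (f g : QSym k) : comul k (f * g) = comul k f * comul k g := by
  apply (MM k).ext_elem
  rintro ⟨u, v⟩
  rw [repr_comul, repr_mul, MM_repr_mul, List.map_append, splitSum_append]
  simp only [repr_comul, strip_append]

theorem comul_one : comul k 1 = 1 := by
  rw [← M_nil, comul, Module.Basis.constr_basis, Algebra.TensorProduct.one_def, ← M_nil]
  simp

instance : Coalgebra k (QSym k) where
  comul := comul k
  counit := (counit k).toLinearMap
  coassoc := deconcat_coassoc (M k) (comul k) (repr_comul k)
  rTensor_counit_comp_comul :=
    deconcat_rTensor_counit (M k) (comul k) (repr_comul k) _ (counit_apply k)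
  lTensor_counit_comp_comul :=
    deconcat_lTensor_counit (M k) (comul k) (repr_comul k) _ (counit_apply k)

instance instBialgebra : Bialgebra k (QSym k) :=
  Bialgebra.mk' k (QSym k) (map_one (counit k)) (map_mul (counit k) _ _) (comul_one k)
    (comul_mul k _ _)

theorem augProj_pow_M (m : ℕ) (w : List ℕ+) (hw : w.length < m) :
    (augProj k (QSym k) ^ m) (M k w) = 0 := by
  induction m generalizing w with
  | zero => simp at hw
  | succ m ih =>
    have h1 : Coalgebra.comul (R := k) (M k w) =
        ∑ i ∈ Finset.range (w.length + 1), M k (w.take i) ⊗ₜ[k] M k (w.drop i) :=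
      Module.Basis.constr_basis _ _ _ _
    rw [pow_succ, LinearMap.convMul_apply, h1, map_sum, map_sum]
    refine Finset.sum_eq_zero fun i hi => ?_
    rw [TensorProduct.map_tmul, LinearMap.mul'_apply]
    have hi' : i ≤ w.length := by simpa [Nat.lt_succ_iff] using hi
    rcases hi'.lt_or_eq with hlt | rfl
    · rw [ih _ (by simp; omega), zero_mul]
    · have h2 : (augProj k (QSym k)) (M k (w.drop w.length)) = 0 := by
        rw [List.drop_length, M_nil]
        change (1 : QSym k) - algebraMap k (QSym k) (Coalgebra.counit (R := k) (1 : QSym k)) = 0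
        simp
      rw [h2, mul_zero]

theorem isConilpotent : IsConilpotent k (QSym k) := by
  intro f
  refine ⟨((M k).repr f).support.sup List.length + 1, fun m hm => ?_⟩
  rw [← (M k).linearCombination_repr f, Finsupp.linearCombination_apply, Finsupp.sum, map_sum]
  refine Finset.sum_eq_zero fun w hw => ?_
  rw [map_smul, augProj_pow_M, smul_zero]
  exact lt_of_lt_of_le (Nat.lt_succ_of_le (Finset.le_sup (f := List.length) hw)) hm

instance instHopfAlgebra : HopfAlgebra k (QSym k) := hopfOfConilpotent (isConilpotent k)

/-- The homogeneous component of degree `n` of `QSym`, spanned by the `M_α` with `|α| = n`. -/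
def grade (n : ℕ) : Submodule k (QSym k) := Submodule.span k (M k '' {w | wt w = n})

theorem mem_grade (n : ℕ) (f : QSym k) :
    f ∈ grade k n ↔ ∀ w, (M k).repr f w ≠ 0 → wt w = n := by
  rw [grade, Module.Basis.mem_span_image]
  simp [Set.subset_def]

instance : SetLike.GradedMonoid (grade k) where
  one_mem := by
    rw [← M_nil]
    exact Submodule.subset_span ⟨[], rfl, rfl⟩
  mul_mem i j f g hf hg := by
    rw [mem_grade] at *
    intro w hw
    rw [repr_mul] at hw
    obtain ⟨s, t, hst, hF⟩ := exists_of_splitSum_ne_zero _ _ hw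
    have h1 := hf _ (left_ne_zero_of_mul hF)
    have h2 := hg _ (right_ne_zero_of_mul hF)
    rw [wt_strip] at h1 h2
    rw [wt, ← hst, h1, h2]

/-- The decomposition of `QSym` into homogeneous components. -/
def decomposeGrade : QSym k →ₗ[k] DirectSum ℕ fun n => grade k n :=
  (M k).constr k fun w =>
    DirectSum.lof k ℕ (fun n => grade k n) (wt w) ⟨M k w, Submodule.subset_span ⟨w, rfl, rfl⟩⟩

theorem decomposeGrade_of_mem (n : ℕ) (f : grade k n) :
    decomposeGrade k (f : QSym k) = DirectSum.lof k ℕ (fun n => grade k n) n f := by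
  obtain ⟨f, hf⟩ := f
  induction hf using Submodule.span_induction with
  | mem x hx =>
    obtain ⟨w, rfl, rfl⟩ := hx
    exact Module.Basis.constr_basis _ _ _ _
  | zero =>
    rw [map_zero]
    exact (map_zero _).symm
  | add x y hx hy h1 h2 =>
    simp only at h1 h2
    rw [map_add, h1, h2, ← map_add]
    rfl
  | smul c x hx h =>
    simp only at h
    rw [map_smul, h, ← map_smul]
    rfl

instance : DirectSum.Decomposition (grade k) where
  decompose' := decomposeGrade k
  left_inv f := by
    have : DirectSum.coeLinearMap (grade k) ∘ₗ decomposeGrade k = LinearMap.id := by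
      refine (M k).ext fun w => ?_
      simp [decomposeGrade]
    exact LinearMap.congr_fun this f
  right_inv x := by
    induction x using DirectSum.induction_on with
    | zero => simp
    | of n f =>
      rw [DirectSum.coeAddMonoidHom_of]
      exact decomposeGrade_of_mem k n f
    | add x y hx hy => rw [map_add, map_add, hx, hy]

instance : GradedAlgebra (grade k) where

theorem finite_firstVar (f : QSym k) : {n : ℕ |
    MvPowerSeries.coeff (Finsupp.single 0 n) (f : MvPowerSeries ℕ k) ≠ 0}.Finite := by
  refine (((M k).repr f).support.image wt).finite_toSet.subset fun n hn => ?_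
  simp only [Set.mem_ofPred_eq, coeff_eq_repr] at hn
  simp only [Finset.coe_image, Set.mem_image, Finset.mem_coe, Finsupp.mem_support_iff]
  refine ⟨_, hn, ?_⟩
  rw [← List.toFinsupp_singleton, expWord_toFinsupp, wt_strip]
  simp

/-- The polynomial obtained from a quasi-symmetric function by setting all variables except the
first one equal to zero (see `coeff_firstVar`). -/
def firstVar (f : QSym k) : Polynomial k :=
  ∑ n ∈ (finite_firstVar k f).toFinset,
    Polynomial.monomial n (MvPowerSeries.coeff (Finsupp.single 0 n) (f : MvPowerSeries ℕ k))

theorem coeff_firstVar (f : QSym k) (n : ℕ) : (firstVar k f).coeff n =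
    MvPowerSeries.coeff (Finsupp.single 0 n) (f : MvPowerSeries ℕ k) := by
  simp only [firstVar, Polynomial.finsetSum_coeff, Polynomial.coeff_monomial,
    Finset.sum_ite_eq', Set.Finite.mem_toFinset, Set.mem_ofPred_eq]
  by_cases h : MvPowerSeries.coeff (Finsupp.single 0 n) (f : MvPowerSeries ℕ k) = 0 <;> simp [h]

/-- The canonical character `ζ_Q` of `QSym`: the morphism of algebras that sets the first variable
equal to `1` and all other variables equal to `0`. -/
def zetaQ : QSym k →ₐ[k] k where
  toFun f := (firstVar k f).eval 1
  map_one' := by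
    have : firstVar k 1 = 1 := by
      classical
      ext n
      rw [coeff_firstVar, Subalgebra.coe_one, MvPowerSeries.coeff_one, Polynomial.coeff_one]
      simp
    rw [this, Polynomial.eval_one]
  map_mul' f g := by
    have : firstVar k (f * g) = firstVar k f * firstVar k g := by
      classical
      ext n
      rw [coeff_firstVar, Subalgebra.coe_mul, MvPowerSeries.coeff_mul, Polynomial.coeff_mul,
        Finsupp.antidiagonal_single, Finset.sum_map]
      simp only [coeff_firstVar]
      rfl
    rw [this, Polynomial.eval_mul]
  map_zero' := by
    have : firstVar k 0 = 0 := by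
      ext n
      rw [coeff_firstVar, Subalgebra.coe_zero, map_zero, Polynomial.coeff_zero]
    rw [this, Polynomial.eval_zero]
  map_add' f g := by
    have : firstVar k (f + g) = firstVar k f + firstVar k g := by
      ext n
      rw [Polynomial.coeff_add, coeff_firstVar, coeff_firstVar, coeff_firstVar, Subalgebra.coe_add,
        map_add]
    rw [this, Polynomial.eval_add]
  commutes' r := by
    have : firstVar k (algebraMap k (QSym k) r) = Polynomial.C r := by
      classical
      ext n
      rw [coeff_firstVar, Subalgebra.coe_algebraMap, MvPowerSeries.algebraMap_apply,
        MvPowerSeries.coeff_C, Polynomial.coeff_C]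
      simp
    rw [this, Polynomial.eval_C]
    rfl

end QSym

end QSymDef

/-! ### Even and odd characters, even and odd subalgebras -/

section EvenOdd

variable {k : Type*} [Field k] {H : Type*} [CommRing H] [HopfAlgebra k H]
  (𝒜 : ℕ → Submodule k H) [GradedAlgebra 𝒜]

/-- The involution `φ ↦ φ̄` on characters, `φ̄(h) = (-1)ⁿ φ(h)` for `h` of degree `n`. Characters are
algebra morphisms `H → k`; they form a group under convolution. -/
def barChar (φ : WithConv (H →ₐ[k] k)) : WithConv (H →ₐ[k] k) :=
  toConv (φ.ofConv.comp (bar 𝒜))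

/-- A character `φ` is even if `φ̄ = φ`. -/
def IsEvenChar (φ : WithConv (H →ₐ[k] k)) : Prop := barChar 𝒜 φ = φ

/-- A character `φ` is odd if `φ̄ = φ⁻¹` in the group of characters. -/
def IsOddChar (φ : WithConv (H →ₐ[k] k)) : Prop := barChar 𝒜 φ = φ⁻¹

/-- The even subalgebra `S(ζ̄, ζ)` of `(H, ζ)`. -/
def evenSub (ζ : WithConv (H →ₐ[k] k)) : Subalgebra k H :=
  largestSub 𝒜 (barChar 𝒜 ζ).ofConv ζ.ofConv

/-- The odd subalgebra `S(ζ̄, ζ⁻¹)` of `(H, ζ)`. -/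
def oddSub (ζ : WithConv (H →ₐ[k] k)) : Subalgebra k H :=
  largestSub 𝒜 (barChar 𝒜 ζ).ofConv (ζ⁻¹).ofConv

end EvenOdd

section Pi

variable (k : Type*) [Field k]

/-- The even subalgebra `Π₊` of `(QSym, ζ_Q)`. -/
def PiPlus : Subalgebra k (QSym k) := evenSub (QSym.grade k) (toConv (QSym.zetaQ k))

/-- The odd subalgebra `Π₋` of `(QSym, ζ_Q)`. -/
def PiMinus : Subalgebra k (QSym k) := oddSub (QSym.grade k) (toConv (QSym.zetaQ k))

theorem isSubcoalgebra_PiPlus : IsSubcoalgebra (Subalgebra.toSubmodule (PiPlus k)) :=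
  (largestSubcoalgebra_mem (QSym.grade k) _ _).2.1

theorem isSubcoalgebra_PiMinus : IsSubcoalgebra (Subalgebra.toSubmodule (PiMinus k)) :=
  (largestSubcoalgebra_mem (QSym.grade k) _ _).2.1

/-- `Π₊` is a Hopf algebra, with the algebra and coalgebra structure restricted from `QSym`. -/
instance instHopfAlgebraPiPlus : HopfAlgebra k (PiPlus k) :=
  letI := restrictBialgebra (PiPlus k) (isSubcoalgebra_PiPlus k)
  hopfOfConilpotent
    (isConilpotent_restrict (QSym.isConilpotent k) (PiPlus k) (isSubcoalgebra_PiPlus k))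

/-- `Π₋` is a Hopf algebra, with the algebra and coalgebra structure restricted from `QSym`. -/
instance instHopfAlgebraPiMinus : HopfAlgebra k (PiMinus k) :=
  letI := restrictBialgebra (PiMinus k) (isSubcoalgebra_PiMinus k)
  hopfOfConilpotent
    (isConilpotent_restrict (QSym.isConilpotent k) (PiMinus k) (isSubcoalgebra_PiMinus k))

/-- The component of degree `n` of `Π₊`. -/
def gradePiPlus (n : ℕ) : Submodule k (PiPlus k) :=
  (QSym.grade k n).comap (PiPlus k).val.toLinearMap

/-- The component of degree `n` of `Π₋`. -/
def gradePiMinus (n : ℕ) : Submodule k (PiMinus k) :=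
  (QSym.grade k n).comap (PiMinus k).val.toLinearMap

/-- The inclusion of `Π₊` in `QSym`, a morphism of Hopf algebras. -/
def inclPlus : PiPlus k →ₐc[k] QSym k :=
  BialgHom.ofAlgHom (PiPlus k).val rfl
    (AlgHom.ext fun b => inclTensor_restrictComul (PiPlus k) (isSubcoalgebra_PiPlus k) b)

/-- The inclusion of `Π₋` in `QSym`, a morphism of Hopf algebras. -/
def inclMinus : PiMinus k →ₐc[k] QSym k :=
  BialgHom.ofAlgHom (PiMinus k).val rfl
    (AlgHom.ext fun b => inclTensor_restrictComul (PiMinus k) (isSubcoalgebra_PiMinus k) b)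

end Pi

end CombHopf

end

open CombHopf WithConv

/-! The pair (`QSym`, ζ_Q) is terminal: for a graded connected bialgebra H, a graded morphism H →
`QSym` is the same as a multiplicative unital functional φ on H. The morphism is h ↦ ∑ (φ_{a₁} * ⋯ *
φ_{a_r})(h) M_{(a₁,…,a_r)}, with φ_n the component of φ in degree n. It respects coproducts because
deconcatenation of words is dual to convolution, and products because Δ is multiplicative
(`wordFun_mul`). It is the only one because the same formula, applied to ζ_Q itself, returns the
coordinates in the basis M (`QSym.wordFun_zetaFun`).

Under this correspondence, morphisms to Π₊ match even functionals and morphisms to Π₋ match odd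
ones: the image of a graded morphism is a graded subcoalgebra, so it lies in S(·,·) as soon as the
two characters agree on it. The product property thus becomes a statement on functionals. Given α₊
and α₋, let α be the morphism induced by the convolution product of their functionals. Pulling ζ_Q =
ζ₊ζ₋ back along α gives a second factorization of that product into an even and an odd functional;
uniqueness of such factorizations (`IsGradedConnected.even_mul_odd_unique`) yields Ψ±∘α = α±. Any
other solution induces the same functional, hence equals α.

Existence of a factorization is needed only for ζ_Q, on the commutative algebra `QSym` with
finite-dimensional components: the odd part is a square root of ζ̄⁻¹ζ, and square roots exist
because the convolution square of the identity is an algebra automorphism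
(`IsGradedConnected.sqHom_bijective`). Uniqueness is needed on an arbitrary H, perhaps
noncommutative and of infinite dimension in each degree. It is therefore proved for linear
functionals, by induction on the degree, from the uniqueness of square roots
(`IsGradedConnected.conv_sq_injective`). Both halves divide by 2. -/

noncomputable section

namespace CombHopf

/-- A graded connected bialgebra. -/
structure IsGradedConnected {k : Type*} [Field k] {H : Type*} [Ring H] [Bialgebra k H]
    (𝒜 : ℕ → Submodule k H) : Prop where
  internal : DirectSum.IsInternal 𝒜
  one_mem : (1 : H) ∈ 𝒜 0
  mul_mem : ∀ m n, ∀ x ∈ 𝒜 m, ∀ y ∈ 𝒜 n, x * y ∈ 𝒜 (m + n)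
  comul_mem : ∀ n, ∀ x ∈ 𝒜 n, Coalgebra.comul (R := k) x ∈
    ⨆ p ∈ Finset.HasAntidiagonal.antidiagonal n, tensorSub (𝒜 p.1) (𝒜 p.2)
  counit_eq_zero : ∀ n, n ≠ 0 → ∀ x ∈ 𝒜 n, Coalgebra.counit (R := k) x = 0
  connected : 𝒜 0 = Submodule.span k {(1 : H)}

theorem IsGradedConnectedHopf.isGradedConnected {k : Type*} [Field k] {H : Type*} [Ring H]
    [HopfAlgebra k H] {𝒜 : ℕ → Submodule k H} (h : IsGradedConnectedHopf 𝒜) :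
    IsGradedConnected 𝒜 :=
  ⟨h.internal, h.one_mem, h.mul_mem, h.comul_mem, h.counit_eq_zero, h.connected⟩

/-! ### Convolution of functionals on graded connected bialgebras -/

namespace IsGradedConnected

variable {k : Type*} [Field k] {H : Type*}

section Bialgebra

variable [Ring H] [Bialgebra k H] {𝒜 : ℕ → Submodule k H}

/-- The graded algebra structure of a graded connected bialgebra. -/
abbrev gradedAlgebra (h : IsGradedConnected 𝒜) : GradedAlgebra 𝒜 where
  __ := h.internal.chooseDecomposition
  one_mem := h.one_mem
  mul_mem m n x y hx hy := h.mul_mem m n x hx y hy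

/-- Serves as an induction principle for Δx: with P a kernel, an equalizer or a preimage, a linear
property of Δx need only be tested on pure tensors of bidegree (p, q) with p + q = n. -/
theorem comul_one_mem (h : IsGradedConnected 𝒜) {n : ℕ} {x : H} (hx : x ∈ 𝒜 n)
    (P : Submodule k (H ⊗[k] H))
    (hP : ∀ p q, p + q = n → ∀ a ∈ 𝒜 p, ∀ b ∈ 𝒜 q, a ⊗ₜ[k] b ∈ P) :
    Coalgebra.comul (R := k) x ∈ P := by
  have : (⨆ p ∈ Finset.HasAntidiagonal.antidiagonal n, tensorSub (𝒜 p.1) (𝒜 p.2)) ≤ P :=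
    iSup₂_le fun p hp => tensorSub_le fun a ha b hb =>
      hP p.1 p.2 (Finset.HasAntidiagonal.mem_antidiagonal.1 hp) a ha b hb
  exact this (h.comul_mem n x hx)

/-- By connectedness the parts of Δx of bidegree (0, n) and (n, 0) are 1 ⊗ y and z ⊗ 1, and the
counit axioms force y = z = x. What remains involves only degrees strictly between 0 and n, which is
what makes the inductions on the degree work. -/
theorem comul_sub_mem (h : IsGradedConnected 𝒜) {n : ℕ} (hn : n ≠ 0) {x : H} (hx : x ∈ 𝒜 n)
    (P : Submodule k (H ⊗[k] H))
    (hP : ∀ p q, p + q = n → p ≠ 0 → q ≠ 0 → ∀ a ∈ 𝒜 p, ∀ b ∈ 𝒜 q, a ⊗ₜ[k] b ∈ P) :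
    Coalgebra.comul (R := k) x - (x ⊗ₜ 1 + 1 ⊗ₜ x) ∈ P := by
  let e₁ : H ⊗[k] H →ₗ[k] H := TensorProduct.lid k H ∘ₗ (Coalgebra.counit (R := k)).rTensor H
  let e₂ : H ⊗[k] H →ₗ[k] H := TensorProduct.rid k H ∘ₗ (Coalgebra.counit (R := k)).lTensor H
  -- The middle terms are also required to be killed by both counit contractions, so that `e₁` and
  -- `e₂` applied to Δx isolate the two outer terms.
  let Q : Submodule k (H ⊗[k] H) := P ⊓ LinearMap.ker e₁ ⊓ LinearMap.ker e₂
  let L : Submodule k (H ⊗[k] H) := (𝒜 n).map (TensorProduct.mk k H H 1)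
  let R : Submodule k (H ⊗[k] H) := (𝒜 n).map ((TensorProduct.mk k H H).flip 1)
  have hmem : Coalgebra.comul (R := k) x ∈ L ⊔ R ⊔ Q := by
    refine h.comul_one_mem hx _ fun p q hpq a ha b hb => ?_
    by_cases hp : p = 0
    · subst hp
      rw [zero_add] at hpq
      subst hpq
      rw [h.connected] at ha
      obtain ⟨c, rfl⟩ := Submodule.mem_span_singleton.1 ha
      refine Submodule.mem_sup_left (Submodule.mem_sup_left ⟨c • b, Submodule.smul_mem _ _ hb, ?_⟩)
      simp [TensorProduct.smul_tmul]
    by_cases hq : q = 0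
    · subst hq
      rw [add_zero] at hpq
      subst hpq
      rw [h.connected] at hb
      obtain ⟨c, rfl⟩ := Submodule.mem_span_singleton.1 hb
      refine Submodule.mem_sup_left (Submodule.mem_sup_right ⟨c • a, Submodule.smul_mem _ _ ha, ?_⟩)
      simp
    refine Submodule.mem_sup_right ⟨⟨hP p q hpq hp hq a ha b hb, ?_⟩, ?_⟩
    · simp [e₁, h.counit_eq_zero p hp a ha]
    · simp [e₂, h.counit_eq_zero q hq b hb]
  obtain ⟨_, hs, r, ⟨⟨hrP, hr₁⟩, hr₂⟩, hr⟩ := Submodule.mem_sup.1 hmem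
  obtain ⟨_, ⟨y, hy, rfl⟩, _, ⟨z, hz, rfl⟩, rfl⟩ := Submodule.mem_sup.1 hs
  have h1 : e₁ (Coalgebra.comul (R := k) x) = x := by simp [e₁]
  have h2 : e₂ (Coalgebra.comul (R := k) x) = x := by simp [e₂]
  have hy0 := h.counit_eq_zero n hn y hy
  have hz0 := h.counit_eq_zero n hn z hz
  have hr₁' : e₁ r = 0 := hr₁
  have hr₂' : e₂ r = 0 := hr₂
  rw [← hr, map_add, hr₁'] at h1
  rw [← hr, map_add, hr₂'] at h2
  have hyx : y = x := by simpa [e₁, hz0] using h1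
  have hzx : z = x := by simpa [e₂, hy0] using h2
  subst hyx hzx
  rw [← hr]
  rwa [TensorProduct.mk_apply, LinearMap.flip_apply, TensorProduct.mk_apply,
    add_comm (1 ⊗ₜ[k] z), add_sub_cancel_left]

theorem linearMap_ext (h : IsGradedConnected 𝒜) {V : Type*} [AddCommGroup V] [Module k V]
    {f g : H →ₗ[k] V} (hfg : ∀ n, ∀ x ∈ 𝒜 n, f x = g x) : f = g := by
  have : (⊤ : Submodule k H) ≤ LinearMap.eqLocus f g := by
    rw [← h.internal.submodule_iSup_eq_top]
    exact iSup_le fun n x hx => hfg n x hx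
  exact LinearMap.ext fun x => this Submodule.mem_top

/-- Once δ vanishes in degrees below n, the equation in degree n reduces to (a(1) + b(1)) δ(x) = 0.
The two-sided form covers both cancellation (b = 0) and the comparison of squares, without any
commutation. -/
theorem eq_zero_of_conv_add_eq_zero (h : IsGradedConnected 𝒜) {a b δ : WithConv (H →ₗ[k] k)}
    (hab : a 1 + b 1 ≠ 0) (hδ : a * δ + δ * b = 0) : δ = 0 := by
  have happ : ∀ x, (a * δ) x + (δ * b) x = 0 := fun x => by
    have := congrArg (fun f : WithConv (H →ₗ[k] k) => f x) hδ
    exact this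
  have h1 : δ 1 = 0 := by
    have := happ 1
    simp only [LinearMap.convMul_apply, Bialgebra.comul_one, Algebra.TensorProduct.one_def,
      TensorProduct.map_tmul, LinearMap.mul'_apply] at this
    have h2 : (a 1 + b 1) * δ 1 = 0 := by linear_combination this
    exact (mul_eq_zero.1 h2).resolve_left hab
  suffices H : ∀ n, ∀ x ∈ 𝒜 n, δ x = 0 by
    ext1
    exact h.linearMap_ext fun n x hx => H n x hx
  intro n
  induction n using Nat.strong_induction_on with
  | _ n ih =>
    intro x hx
    by_cases hn : n = 0
    · subst hn
      rw [h.connected] at hx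
      obtain ⟨c, rfl⟩ := Submodule.mem_span_singleton.1 hx
      rw [map_smul, h1, smul_zero]
    have key := h.comul_sub_mem hn hx (LinearMap.ker (LinearMap.mul' k k ∘ₗ
      TensorProduct.map a.ofConv δ.ofConv + LinearMap.mul' k k ∘ₗ
      TensorProduct.map δ.ofConv b.ofConv)) fun p q hpq hp hq u hu v hv => by
        simp [ih p (by omega) u hu, ih q (by omega) v hv]
    rw [LinearMap.mem_ker, map_sub] at key
    have h2 := happ x
    rw [LinearMap.convMul_apply, LinearMap.convMul_apply] at h2
    simp only [LinearMap.add_apply, LinearMap.comp_apply, h2, map_add, TensorProduct.map_tmul,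
      LinearMap.mul'_apply, h1] at key
    have h3 : (a 1 + b 1) * δ x = 0 := by linear_combination -key
    exact (mul_eq_zero.1 h3).resolve_left hab

theorem conv_cancel (h : IsGradedConnected 𝒜) {a φ ψ : WithConv (H →ₗ[k] k)}
    (ha : a 1 = 1) (hφ : a * φ = a * ψ) : φ = ψ := by
  refine sub_eq_zero.1 (h.eq_zero_of_conv_add_eq_zero (a := a) (b := 0) ?_ ?_)
  · change a 1 + 0 ≠ 0
    simp [ha]
  · rw [mul_sub, hφ, sub_self, mul_zero, add_zero]

/-- In any ring φ² − ψ² = φ(φ − ψ) + (φ − ψ)ψ, and here the leading coefficient φ(1) + ψ(1) is 2. -/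
theorem conv_sq_injective (h : IsGradedConnected 𝒜) (hk : (2 : k) ≠ 0)
    {φ ψ : WithConv (H →ₗ[k] k)} (hφ : φ 1 = 1) (hψ : ψ 1 = 1) (hsq : φ * φ = ψ * ψ) :
    φ = ψ := by
  refine sub_eq_zero.1 (h.eq_zero_of_conv_add_eq_zero (a := φ) (b := ψ) ?_ ?_)
  · rw [hφ, hψ, one_add_one_eq_two]
    exact hk
  · rw [mul_sub, sub_mul, hsq]
    abel

/-- `barLinear` is a morphism of coalgebras. -/
theorem comul_barLinear [GradedAlgebra 𝒜] (h : IsGradedConnected 𝒜) (x : H) :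
    Coalgebra.comul (R := k) (barLinear 𝒜 x) =
      TensorProduct.map (barLinear 𝒜) (barLinear 𝒜) (Coalgebra.comul (R := k) x) := by
  refine LinearMap.congr_fun (f := Coalgebra.comul (R := k) ∘ₗ barLinear 𝒜)
    (g := TensorProduct.map (barLinear 𝒜) (barLinear 𝒜) ∘ₗ Coalgebra.comul (R := k))
    (h.linearMap_ext fun n x hx => ?_) x
  rw [LinearMap.comp_apply, LinearMap.comp_apply, barLinear_of_mem 𝒜 hx, map_smul]
  refine h.comul_one_mem hx (LinearMap.eqLocus ((-1 : k) ^ n • LinearMap.id)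
    (TensorProduct.map (barLinear 𝒜) (barLinear 𝒜))) fun p q hpq a ha b hb => ?_
  rw [LinearMap.mem_eqLocus, TensorProduct.map_tmul, barLinear_of_mem 𝒜 ha,
    barLinear_of_mem 𝒜 hb, TensorProduct.smul_tmul_smul, ← pow_add, hpq]
  rfl

/-- The involution `h ↦ (-1)ⁿ h` on linear functionals. -/
def barFun (𝒜 : ℕ → Submodule k H) [GradedAlgebra 𝒜] (φ : WithConv (H →ₗ[k] k)) :
    WithConv (H →ₗ[k] k) :=
  toConv (φ.ofConv ∘ₗ barLinear 𝒜)

theorem barFun_apply_of_mem [GradedAlgebra 𝒜] (φ : WithConv (H →ₗ[k] k)) {n : ℕ} {x : H}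
    (hx : x ∈ 𝒜 n) : barFun 𝒜 φ x = (-1 : k) ^ n * φ x := by
  change φ.ofConv (barLinear 𝒜 x) = _
  rw [barLinear_of_mem 𝒜 hx, map_smul, smul_eq_mul]

theorem barFun_one_apply [GradedAlgebra 𝒜] (h : IsGradedConnected 𝒜)
    (φ : WithConv (H →ₗ[k] k)) : barFun 𝒜 φ 1 = φ 1 := by
  rw [barFun_apply_of_mem φ h.one_mem, pow_zero, one_mul]

theorem barFun_barFun [GradedAlgebra 𝒜] (h : IsGradedConnected 𝒜)
    (φ : WithConv (H →ₗ[k] k)) : barFun 𝒜 (barFun 𝒜 φ) = φ := by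
  ext1
  refine h.linearMap_ext fun n x hx => ?_
  rw [barFun_apply_of_mem _ hx, barFun_apply_of_mem _ hx, ← mul_assoc, ← mul_pow]
  simp

theorem barFun_mul [GradedAlgebra 𝒜] (h : IsGradedConnected 𝒜)
    (φ ψ : WithConv (H →ₗ[k] k)) : barFun 𝒜 (φ * ψ) = barFun 𝒜 φ * barFun 𝒜 ψ := by
  ext x
  change (φ * ψ).ofConv (barLinear 𝒜 x) = _
  rw [LinearMap.convMul_apply, h.comul_barLinear, LinearMap.convMul_apply,
    ← LinearMap.comp_apply (TensorProduct.map _ _), ← TensorProduct.map_comp]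
  rfl

theorem barFun_one [GradedAlgebra 𝒜] (h : IsGradedConnected 𝒜) :
    barFun 𝒜 (1 : WithConv (H →ₗ[k] k)) = 1 := by
  ext1
  refine h.linearMap_ext fun n x hx => ?_
  rw [barFun_apply_of_mem _ hx]
  by_cases hn : n = 0
  · simp [hn]
  · simp [h.counit_eq_zero n hn x hx]

/-- Uniqueness of the decomposition of a functional into an even and an odd one. -/
theorem even_mul_odd_unique [GradedAlgebra 𝒜] (h : IsGradedConnected 𝒜) (hk : (2 : k) ≠ 0)
    {φ φ' ψ ψ' : WithConv (H →ₗ[k] k)} (hφ : barFun 𝒜 φ = φ) (hφ' : barFun 𝒜 φ' = φ')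
    (hψ : barFun 𝒜 ψ * ψ = 1) (hψ' : barFun 𝒜 ψ' * ψ' = 1) (hφ1 : φ 1 = 1)
    (hψ1 : ψ 1 = 1) (hψ1' : ψ' 1 = 1) (heq : φ * ψ = φ' * ψ') : φ = φ' ∧ ψ = ψ' := by
  -- The involution fixes the even factor and inverts the odd one, so φψ⁻¹ = φ'ψ'⁻¹ as well as φψ =
  -- φ'ψ'.
  have hbar : φ * barFun 𝒜 ψ = φ' * barFun 𝒜 ψ' := by
    have := congrArg (barFun 𝒜) heq
    rwa [h.barFun_mul, h.barFun_mul, hφ, hφ'] at this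
  have hψ_eq : ψ = ψ' := by
    -- Cancelling the common factor φψ⁻¹ from (φψ⁻¹)ψ² = φψ = φ'ψ' = (φψ⁻¹)ψ'² leaves ψ² = ψ'².
    refine h.conv_sq_injective hk hψ1 hψ1' (h.conv_cancel (a := φ * barFun 𝒜 ψ) ?_ ?_)
    · have h2 := h.barFun_one_apply ψ
      rw [LinearMap.convMul_apply, Bialgebra.comul_one, Algebra.TensorProduct.one_def,
        TensorProduct.map_tmul, LinearMap.mul'_apply, h2, hφ1, hψ1, one_mul]
    · calc φ * barFun 𝒜 ψ * (ψ * ψ) = φ * (barFun 𝒜 ψ * ψ) * ψ := by simp only [mul_assoc]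
        _ = φ' * (barFun 𝒜 ψ' * ψ') * ψ' := by rw [hψ, hψ', mul_one, mul_one, heq]
        _ = φ * barFun 𝒜 ψ * (ψ' * ψ') := by rw [hbar]; simp only [mul_assoc]
  refine ⟨?_, hψ_eq⟩
  subst hψ_eq
  -- The hypothesis gives a left inverse only; applying the involution to it gives the right
  -- inverse.
  have hinv : ψ * barFun 𝒜 ψ = 1 := by
    have := congrArg (barFun 𝒜) hψ
    rwa [h.barFun_mul, h.barFun_barFun, h.barFun_one] at this
  calc φ = φ * (ψ * barFun 𝒜 ψ) := by rw [hinv, mul_one]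
    _ = φ' * (ψ * barFun 𝒜 ψ) := by rw [← mul_assoc, heq, mul_assoc]
    _ = φ' := by rw [hinv, mul_one]

end Bialgebra

/-- In positive degree the antipode axiom reads S(x) + x + ∑ S(x')x'' = 0 with x' and x'' of lower
positive degree, so homogeneity follows by induction. This is why `IsGradedConnected` can do without
the antipode. -/
theorem antipode_mem [Ring H] [HopfAlgebra k H] {𝒜 : ℕ → Submodule k H}
    (h : IsGradedConnected 𝒜) (n : ℕ) : ∀ x ∈ 𝒜 n, HopfAlgebra.antipode k x ∈ 𝒜 n := by
  induction n using Nat.strong_induction_on with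
  | _ n ih =>
    intro x hx
    by_cases hn : n = 0
    · subst hn
      rw [h.connected] at hx
      obtain ⟨c, rfl⟩ := Submodule.mem_span_singleton.1 hx
      rw [map_smul, HopfAlgebra.antipode_one]
      exact Submodule.smul_mem _ _ h.one_mem
    have key := h.comul_sub_mem hn hx ((𝒜 n).comap (LinearMap.mul' k H ∘ₗ
      (HopfAlgebra.antipode k).rTensor H)) fun p q hpq hp hq a ha b hb => by
        simpa [← hpq] using h.mul_mem p q _ (ih p (by omega) a ha) b hb
    rw [Submodule.mem_comap, map_sub, LinearMap.comp_apply,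
      HopfAlgebra.mul_antipode_rTensor_comul_apply, h.counit_eq_zero n hn x hx] at key
    simp only [map_zero, zero_sub, map_add, LinearMap.comp_apply, LinearMap.rTensor_tmul,
      LinearMap.mul'_apply, mul_one, HopfAlgebra.antipode_one, one_mul] at key
    have := (𝒜 n).sub_mem ((𝒜 n).neg_mem key) hx
    simpa using this

theorem isGradedConnectedHopf [Ring H] [HopfAlgebra k H] {𝒜 : ℕ → Submodule k H}
    (h : IsGradedConnected 𝒜) : IsGradedConnectedHopf 𝒜 :=
  ⟨h.internal, h.one_mem, h.mul_mem, h.comul_mem, h.counit_eq_zero, h.antipode_mem, h.connected⟩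

/-! ### The convolution square of the identity -/

section Square

variable [CommRing H] [Bialgebra k H] {𝒜 : ℕ → Submodule k H}

/-- The convolution square `m ∘ Δ` of the identity of a commutative bialgebra. -/
def sqHom (k H : Type*) [Field k] [CommRing H] [Bialgebra k H] : H →ₐ[k] H :=
  (Algebra.TensorProduct.lmul' k).comp (Bialgebra.comulAlgHom k H)

theorem sqHom_mem (h : IsGradedConnected 𝒜) {n : ℕ} {x : H} (hx : x ∈ 𝒜 n) :
    sqHom k H x ∈ 𝒜 n :=
  h.comul_one_mem hx ((𝒜 n).comap (Algebra.TensorProduct.lmul' k (S := H)).toLinearMap)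
    fun p q hpq a ha b hb => by simpa [← hpq] using h.mul_mem p q a ha b hb

/-- Write T = m∘Δ, an algebra morphism since H is commutative. Then T(x) = 2x + (products of
elements of lower positive degree), and by induction these products form some T(y) with y of the
same degree. Hence x = T((x − y)/2). -/
theorem mem_map_sqHom (h : IsGradedConnected 𝒜) (hk : (2 : k) ≠ 0) (n : ℕ) :
    𝒜 n ≤ (𝒜 n).map (sqHom k H).toLinearMap := by
  induction n using Nat.strong_induction_on with
  | _ n ih =>
    intro x hx
    by_cases hn : n = 0
    · subst hn
      rw [h.connected] at hx ⊢
      obtain ⟨c, rfl⟩ := Submodule.mem_span_singleton.1 hx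
      exact ⟨c • 1, hx, by simp⟩
    have key := h.comul_sub_mem hn hx (((𝒜 n).map (sqHom k H).toLinearMap).comap
      (Algebra.TensorProduct.lmul' k (S := H)).toLinearMap) fun p q hpq hp hq a ha b hb => by
        obtain ⟨a, ha', rfl⟩ := ih p (by omega) ha
        obtain ⟨b, hb', rfl⟩ := ih q (by omega) hb
        exact ⟨a * b, hpq ▸ h.mul_mem p q a ha' b hb', by simp⟩
    obtain ⟨y, hy, hyx⟩ := key
    refine ⟨(2 : k)⁻¹ • (x - y), Submodule.smul_mem _ _ (Submodule.sub_mem _ hx hy), ?_⟩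
    have h2 : sqHom k H y = sqHom k H x - (x + x) := by
      have h3 : sqHom k H x = Algebra.TensorProduct.lmul' k (S := H)
        (Coalgebra.comul (R := k) x) := rfl
      rw [h3]
      simpa using hyx
    rw [AlgHom.toLinearMap_apply, map_smul, map_sub, h2, sub_sub_cancel, ← two_smul k x,
      smul_smul, inv_mul_cancel₀ hk, one_smul]

/-- A surjective endomorphism of a finite-dimensional component is injective. -/
theorem sqHom_bijective (h : IsGradedConnected 𝒜) (hk : (2 : k) ≠ 0)
    (hfin : ∀ n, Module.Finite k (𝒜 n)) : Function.Bijective (sqHom k H) := by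
  have hinj : ∀ n, ∀ x ∈ 𝒜 n, sqHom k H x = 0 → x = 0 := by
    intro n x hx hx0
    let T : 𝒜 n →ₗ[k] 𝒜 n := (sqHom k H).toLinearMap.restrict fun x hx => h.sqHom_mem hx
    have hsurj : Function.Surjective T := by
      rintro ⟨y, hy⟩
      obtain ⟨z, hz, rfl⟩ := h.mem_map_sqHom hk n hy
      exact ⟨⟨z, hz⟩, rfl⟩
    have := hfin n
    have hT := (LinearMap.injective_iff_surjective.2 hsurj)
    have : (⟨x, hx⟩ : 𝒜 n) = 0 := hT (by rw [map_zero]; exact Subtype.ext hx0)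
    exact congrArg Subtype.val this
  constructor
  · let _ := h.gradedAlgebra
    rw [injective_iff_map_eq_zero]
    intro x hx
    -- Injectivity passes from the components to H because the map commutes with taking homogeneous
    -- parts.
    have hcomm : ∀ n y, (DirectSum.decompose 𝒜 (sqHom k H y) n : H) =
        sqHom k H (DirectSum.decompose 𝒜 y n) := by
      intro n y
      induction y using DirectSum.Decomposition.inductionOn 𝒜 with
      | zero => simp
      | add a b ha hb =>
        simp only [map_add, DirectSum.decompose_add, DirectSum.add_apply, Submodule.coe_add,
          ha, hb]
      | @homogeneous i a =>
        by_cases hin : i = n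
        · subst hin
          rw [DirectSum.decompose_of_mem_same _ (h.sqHom_mem a.2),
            DirectSum.decompose_of_mem_same _ a.2]
        · rw [DirectSum.decompose_of_mem_ne _ (h.sqHom_mem a.2) hin,
            DirectSum.decompose_of_mem_ne _ a.2 hin, map_zero]
    classical
    rw [← DirectSum.sum_support_decompose 𝒜 x]
    refine Finset.sum_eq_zero fun n _ => hinj n _ (SetLike.coe_mem _) ?_
    rw [← hcomm, hx]
    simp
  · have : (⊤ : Submodule k H) ≤ LinearMap.range (sqHom k H).toLinearMap := by
      rw [← h.internal.submodule_iSup_eq_top]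
      exact iSup_le fun n => (h.mem_map_sqHom hk n).trans LinearMap.map_le_range
    exact fun y => this (Submodule.mem_top (x := y))

end Square

end IsGradedConnected

/-! ### Morphisms to `QSym` from functionals: the terminal property -/

theorem splitSum_sum {R ι : Type*} [AddCommMonoid R] (s : Finset ι) (u : List ℕ)
    (F : ι → List ℕ → List ℕ → R) :
    splitSum u (fun a b => ∑ i ∈ s, F i a b) = ∑ i ∈ s, splitSum u (F i) := by
  classical
  induction s using Finset.induction_on with
  | empty => simp [splitSum_zero]
  | insert i s hi ih =>
    simp only [Finset.sum_insert hi]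
    rw [← ih, splitSum_add]

section Words

variable {k : Type*} [Field k] {H : Type*} [Ring H] [Bialgebra k H] (𝒜 : ℕ → Submodule k H)
  [GradedAlgebra 𝒜]

theorem proj_of_mem_same {n : ℕ} {x : H} (hx : x ∈ 𝒜 n) : GradedAlgebra.proj 𝒜 n x = x := by
  rw [GradedAlgebra.proj_apply, DirectSum.decompose_of_mem_same _ hx]

theorem proj_of_mem_ne {m n : ℕ} (hmn : m ≠ n) {x : H} (hx : x ∈ 𝒜 m) :
    GradedAlgebra.proj 𝒜 n x = 0 := by
  rw [GradedAlgebra.proj_apply, DirectSum.decompose_of_mem_ne _ hx hmn]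

/-- The restriction of a linear functional to the component of degree `n`, extended by zero. -/
def compFun (φ : WithConv (H →ₗ[k] k)) (n : ℕ) : WithConv (H →ₗ[k] k) :=
  toConv (φ.ofConv ∘ₗ GradedAlgebra.proj 𝒜 n)

theorem compFun_apply_same (φ : WithConv (H →ₗ[k] k)) {n : ℕ} {x : H} (hx : x ∈ 𝒜 n) :
    compFun 𝒜 φ n x = φ x :=
  congrArg φ.ofConv (proj_of_mem_same 𝒜 hx)

theorem compFun_apply_ne (φ : WithConv (H →ₗ[k] k)) {m n : ℕ} (hmn : m ≠ n) {x : H}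
    (hx : x ∈ 𝒜 m) : compFun 𝒜 φ n x = 0 :=
  (congrArg φ.ofConv (proj_of_mem_ne 𝒜 hmn hx)).trans (map_zero _)

/-- The convolution product `φ_{a₁} * ⋯ * φ_{a_r}` of homogeneous components of `φ`. -/
def wordFun (φ : WithConv (H →ₗ[k] k)) (w : List ℕ+) : WithConv (H →ₗ[k] k) :=
  (w.map fun a : ℕ+ => compFun 𝒜 φ a).prod

theorem wordFun_nil (φ : WithConv (H →ₗ[k] k)) : wordFun 𝒜 φ [] = 1 := rfl

theorem wordFun_cons (φ : WithConv (H →ₗ[k] k)) (a : ℕ+) (w : List ℕ+) :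
    wordFun 𝒜 φ (a :: w) = compFun 𝒜 φ a * wordFun 𝒜 φ w :=
  List.prod_cons

theorem wordFun_append (φ : WithConv (H →ₗ[k] k)) (u v : List ℕ+) :
    wordFun 𝒜 φ (u ++ v) = wordFun 𝒜 φ u * wordFun 𝒜 φ v := by
  rw [wordFun, List.map_append, List.prod_append]
  rfl

variable {𝒜}

/-- Degrees add under convolution, so φ_{a₁} * ⋯ * φ_{a_r} lives in degree a₁ + ⋯ + a_r. -/
theorem wordFun_eq_zero (h : IsGradedConnected 𝒜) (φ : WithConv (H →ₗ[k] k)) (w : List ℕ+) :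
    ∀ n, wt w ≠ n → ∀ x ∈ 𝒜 n, wordFun 𝒜 φ w x = 0 := by
  induction w with
  | nil =>
    intro n hn x hx
    rw [wordFun_nil, LinearMap.convOne_apply, h.counit_eq_zero n (Ne.symm hn) x hx, map_zero]
  | cons a w ih =>
    intro n hn x hx
    rw [wordFun_cons, LinearMap.convMul_apply]
    refine h.comul_one_mem hx (LinearMap.ker (LinearMap.mul' k k ∘ₗ TensorProduct.map
      (compFun 𝒜 φ a).ofConv (wordFun 𝒜 φ w).ofConv)) fun p q hpq b hb c hc => ?_
    rw [LinearMap.mem_ker, LinearMap.comp_apply, TensorProduct.map_tmul, LinearMap.mul'_apply]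
    by_cases hp : p = a
    · rw [ih q (fun hq => hn (by rw [← hpq, hp, ← hq]; simp [wt])) c hc, mul_zero]
    · rw [compFun_apply_ne 𝒜 φ hp hb, zero_mul]

/-- Only finitely many words have a given weight. This makes the sum that defines `toQSym` finite.
-/
theorem finite_wordFun (h : IsGradedConnected 𝒜) (φ : WithConv (H →ₗ[k] k)) (x : H) :
    (Function.support fun w => wordFun 𝒜 φ w x).Finite := by
  induction x using DirectSum.Decomposition.inductionOn 𝒜 with
  | zero => simp
  | add a b ha hb =>
    refine (ha.union hb).subset fun w hw => ?_
    by_contra hcon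
    simp only [Set.mem_union, Function.mem_support, not_or, not_not] at hcon
    exact hw (by simp [hcon.1, hcon.2])
  | @homogeneous n a =>
    refine (finite_words n).subset fun w hw => ?_
    by_contra hcon
    exact hw (wordFun_eq_zero h φ w n (fun hn => hcon hn.le) a a.2)

theorem compFun_zero (h : IsGradedConnected 𝒜) {φ : WithConv (H →ₗ[k] k)} (hφ : φ 1 = 1) :
    compFun 𝒜 φ 0 = 1 := by
  ext1
  refine h.linearMap_ext fun n x hx => ?_
  by_cases hn : n = 0
  · subst hn
    rw [compFun_apply_same 𝒜 φ hx]
    rw [h.connected] at hx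
    obtain ⟨c, rfl⟩ := Submodule.mem_span_singleton.1 hx
    simp [hφ]
  · rw [compFun_apply_ne 𝒜 φ hn hx]
    simp [h.counit_eq_zero n hn x hx]

/-- A letter 0 stands for φ₀, which by connectedness is the convolution unit. The zeros that
`splitSum` produces may therefore be dropped. -/
theorem wordFun_strip_cons (h : IsGradedConnected 𝒜) {φ : WithConv (H →ₗ[k] k)} (hφ : φ 1 = 1)
    (a : ℕ) (l : List ℕ) :
    wordFun 𝒜 φ (strip (a :: l)) = compFun 𝒜 φ a * wordFun 𝒜 φ (strip l) := by
  by_cases ha : a = 0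
  · subst ha
    rw [strip_cons_zero, compFun_zero h hφ, one_mul]
  · rw [strip_cons_pos ha, wordFun_cons]
    have : ((a.toPNat' : ℕ+) : ℕ) = a := by simp; omega
    rw [this]

theorem compFun_mul (h : IsGradedConnected 𝒜) {φ : WithConv (H →ₗ[k] k)}
    (hmul : ∀ x y, φ (x * y) = φ x * φ y) (n : ℕ) (x y : H) :
    compFun 𝒜 φ n (x * y) = ∑ p ∈ Finset.HasAntidiagonal.antidiagonal n,
      compFun 𝒜 φ p.1 x * compFun 𝒜 φ p.2 y := by
  induction x using DirectSum.Decomposition.inductionOn 𝒜 with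
  | zero => simp
  | add a b ha hb => simp only [add_mul, map_add, ha, hb, Finset.sum_add_distrib]
  | @homogeneous i a =>
    induction y using DirectSum.Decomposition.inductionOn 𝒜 with
    | zero => simp
    | add c d hc hd => simp only [mul_add, map_add, hc, hd, Finset.sum_add_distrib]
    | @homogeneous j c =>
      have hac := h.mul_mem i j a a.2 c c.2
      by_cases hn : i + j = n
      · subst hn
        rw [compFun_apply_same 𝒜 φ hac, hmul, Finset.sum_eq_single (i, j)]
        · rw [compFun_apply_same 𝒜 φ a.2, compFun_apply_same 𝒜 φ c.2]
        · rintro ⟨p, q⟩ hpq hne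
          rw [Finset.HasAntidiagonal.mem_antidiagonal] at hpq
          have : i ≠ p := by
            rintro rfl
            exact hne (by simp only [Prod.mk.injEq, true_and]; simpa using hpq)
          rw [compFun_apply_ne 𝒜 φ this a.2, zero_mul]
        · simp
      · rw [compFun_apply_ne 𝒜 φ hn hac]
        symm
        refine Finset.sum_eq_zero ?_
        rintro ⟨p, q⟩ hpq
        rw [Finset.HasAntidiagonal.mem_antidiagonal] at hpq
        by_cases hp : i = p
        · have hq : j ≠ q := by
            rintro rfl
            exact hn (hp ▸ hpq)
          rw [compFun_apply_ne 𝒜 φ hq c.2, mul_zero]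
        · rw [compFun_apply_ne 𝒜 φ hp a.2, zero_mul]

theorem conv_apply_mul (f g : WithConv (H →ₗ[k] k)) (x y : H) :
    (f * g) (x * y) = ∑ i ∈ (Coalgebra.Repr.arbitrary k x).index,
      ∑ j ∈ (Coalgebra.Repr.arbitrary k y).index,
        f ((Coalgebra.Repr.arbitrary k x).left i * (Coalgebra.Repr.arbitrary k y).left j) *
        g ((Coalgebra.Repr.arbitrary k x).right i * (Coalgebra.Repr.arbitrary k y).right j) := by
  rw [((Coalgebra.Repr.arbitrary k x).mul (Coalgebra.Repr.arbitrary k y)).convMul_apply,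
    ← Finset.sum_product']
  rfl

/-- Since Δ(xy) = Δ(x)Δ(y), the first letter a is shared as a = p + q between x and y, and the rest
of the word by induction. The outcome is the coefficient rule `QSym.repr_mul`. Commutativity is used
in k only, never in H. -/
theorem wordFun_mul (h : IsGradedConnected 𝒜) {φ : WithConv (H →ₗ[k] k)} (hφ : φ 1 = 1)
    (hmul : ∀ x y, φ (x * y) = φ x * φ y) (w : List ℕ+) :
    ∀ x y, wordFun 𝒜 φ w (x * y) = splitSum (w.map (fun a : ℕ+ => (a : ℕ)))
      (fun s t => wordFun 𝒜 φ (strip s) x * wordFun 𝒜 φ (strip t) y) := by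
  induction w with
  | nil =>
    intro x y
    change (1 : WithConv (H →ₗ[k] k)) (x * y) =
      (1 : WithConv (H →ₗ[k] k)) x * (1 : WithConv (H →ₗ[k] k)) y
    simp
  | cons a w ih =>
    intro x y
    rw [wordFun_cons, conv_apply_mul]
    simp only [List.map_cons, splitSum, wordFun_strip_cons h hφ, compFun_mul h hmul, ih]
    simp only [(Coalgebra.Repr.arbitrary k x).convMul_apply,
      (Coalgebra.Repr.arbitrary k y).convMul_apply, splitSum_sum, Finset.sum_mul, Finset.mul_sum]
    simp only [mul_comm _ (splitSum _ _), splitSum_mul]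
    -- The two sides now differ by the order of summation over the splittings of a and the terms of
    -- Δx and Δy, and by the order of scalar factors.
    rw [Finset.sum_congr rfl fun i _ => Finset.sum_comm, Finset.sum_comm]
    refine Finset.sum_congr rfl fun p _ => Finset.sum_comm.trans <|
      Finset.sum_congr rfl fun j _ => Finset.sum_congr rfl fun i _ => congrArg (splitSum _) ?_
    funext s t
    ring

/-- The morphism of coalgebras to `QSym` induced by a linear functional. -/
def toQSym (h : IsGradedConnected 𝒜) (φ : WithConv (H →ₗ[k] k)) : H →ₗ[k] QSym k :=
  (QSym.M k).repr.symm.toLinearMap ∘ₗ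
    { toFun := fun x => Finsupp.ofSupportFinite _ (finite_wordFun h φ x)
      map_add' := fun x y => by
        ext w
        exact map_add (wordFun 𝒜 φ w).ofConv x y
      map_smul' := fun c x => by
        ext w
        exact map_smul (wordFun 𝒜 φ w).ofConv c x }

theorem repr_toQSym (h : IsGradedConnected 𝒜) (φ : WithConv (H →ₗ[k] k)) (x : H)
    (w : List ℕ+) : (QSym.M k).repr (toQSym h φ x) w = wordFun 𝒜 φ w x := by
  rw [toQSym, LinearMap.comp_apply, LinearEquiv.coe_coe, LinearEquiv.apply_symm_apply]
  rfl

theorem toQSym_mem (h : IsGradedConnected 𝒜) (φ : WithConv (H →ₗ[k] k)) :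
    PreservesGrading 𝒜 (QSym.grade k) (toQSym h φ) := by
  intro n x hx
  rw [QSym.mem_grade]
  intro w hw
  rw [repr_toQSym] at hw
  by_contra hn
  exact hw (wordFun_eq_zero h φ w n hn x hx)

theorem QSym.MM_repr_map {V W : Type*} [AddCommGroup V] [Module k V] [AddCommGroup W] [Module k W]
    (f : V →ₗ[k] QSym k) (g : W →ₗ[k] QSym k) (t : V ⊗[k] W) (u v : List ℕ+) :
    (QSym.MM k).repr (TensorProduct.map f g t) (u, v) =
      LinearMap.mul' k k (TensorProduct.map ((QSym.M k).coord u ∘ₗ f)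
        ((QSym.M k).coord v ∘ₗ g) t) := by
  induction t with
  | zero => simp
  | add x y hx hy => simp only [map_add, Finsupp.add_apply, hx, hy]
  | tmul x y => simp [QSym.MM_repr_tmul]

/-- The coefficient of M_u ⊗ M_v in a deconcatenation coproduct is the coefficient of M_{uv}, and
`wordFun` turns concatenation into convolution. -/
theorem comul_toQSym (h : IsGradedConnected 𝒜) (φ : WithConv (H →ₗ[k] k)) (x : H) :
    TensorProduct.map (toQSym h φ) (toQSym h φ) (Coalgebra.comul (R := k) x) =
      Coalgebra.comul (R := k) (toQSym h φ x) := by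
  apply (QSym.MM k).ext_elem
  rintro ⟨u, v⟩
  have hcoord : ∀ u, (QSym.M k).coord u ∘ₗ toQSym h φ = (wordFun 𝒜 φ u).ofConv := fun u =>
    LinearMap.ext fun x => repr_toQSym h φ x u
  rw [QSym.MM_repr_map, hcoord, hcoord]
  refine Eq.trans ?_ (QSym.repr_comul k _ u v).symm
  rw [repr_toQSym, wordFun_append, LinearMap.convMul_apply]

theorem toQSym_one (h : IsGradedConnected 𝒜) (φ : WithConv (H →ₗ[k] k)) :
    toQSym h φ 1 = 1 := by
  rw [← QSym.M_nil]
  apply (QSym.M k).ext_elem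
  intro w
  rw [repr_toQSym, Module.Basis.repr_self]
  cases w with
  | nil => simp [wordFun_nil]
  | cons a w =>
    rw [wordFun_eq_zero h φ _ 0 (by simp [wt]) 1 h.one_mem]
    simp

theorem toQSym_mul (h : IsGradedConnected 𝒜) {φ : WithConv (H →ₗ[k] k)} (hφ : φ 1 = 1)
    (hmul : ∀ x y, φ (x * y) = φ x * φ y) (x y : H) :
    toQSym h φ (x * y) = toQSym h φ x * toQSym h φ y := by
  apply (QSym.M k).ext_elem
  intro w
  rw [repr_toQSym, QSym.repr_mul, wordFun_mul h hφ hmul]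
  simp only [repr_toQSym]

/-- The morphism of bialgebras to `QSym` induced by a character. -/
def toQSymHom (h : IsGradedConnected 𝒜) {φ : WithConv (H →ₗ[k] k)} (hφ : φ 1 = 1)
    (hmul : ∀ x y, φ (x * y) = φ x * φ y) : H →ₐc[k] QSym k :=
  BialgHom.ofAlgHom (AlgHom.ofLinearMap (toQSym h φ) (toQSym_one h φ) (toQSym_mul h hφ hmul))
    (AlgHom.ext fun x => by
      change QSym.counit k (toQSym h φ x) = Coalgebra.counit (R := k) x
      rw [QSym.counit_apply, repr_toQSym]
      rfl)
    (AlgHom.ext fun x => comul_toQSym h φ x)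

/-- With a single variable left, M_α survives only if α has at most one part. For n = 0, `strip [n]`
is the empty word, so degree 0 needs no separate treatment. -/
theorem QSym.zetaQ_of_mem {n : ℕ} {f : QSym k} (hf : f ∈ QSym.grade k n) :
    QSym.zetaQ k f = (QSym.M k).repr f (strip [n]) := by
  have hpoly : QSym.firstVar k f = Polynomial.monomial n ((QSym.M k).repr f (strip [n])) := by
    ext m
    rw [QSym.coeff_firstVar, QSym.coeff_eq_repr, ← List.toFinsupp_singleton, expWord_toFinsupp,
      Polynomial.coeff_monomial]
    split_ifs with hnm
    · rw [hnm]
    · by_contra h0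
      have := (QSym.mem_grade k n f).1 hf _ h0
      rw [wt_strip] at this
      exact hnm (by simpa using this.symm)
  change (QSym.firstVar k f).eval 1 = _
  rw [hpoly, Polynomial.eval_monomial, one_pow, mul_one]

theorem QSym.linearMap_ext {V : Type*} [AddCommGroup V] [Module k V] {f g : QSym k →ₗ[k] V}
    (hfg : ∀ n, ∀ x ∈ QSym.grade k n, f x = g x) : f = g :=
  (QSym.M k).ext fun w => hfg (wt w) _ (Submodule.subset_span ⟨w, rfl, rfl⟩)

/-- The canonical character of `QSym` as a linear functional. -/
def QSym.zetaFun (k : Type*) [Field k] : WithConv (QSym k →ₗ[k] k) :=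
  toConv (QSym.zetaQ k).toLinearMap

theorem QSym.compFun_zetaFun (a : ℕ+) :
    compFun (QSym.grade k) (QSym.zetaFun k) a = toConv ((QSym.M k).coord [a]) := by
  ext1
  refine QSym.linearMap_ext fun n f hf => ?_
  have hstrip : strip [(a : ℕ)] = [a] := strip_coe [a]
  by_cases hn : n = a
  · subst hn
    rw [compFun_apply_same (QSym.grade k) _ hf]
    change QSym.zetaQ k f = (QSym.M k).repr f [a]
    rw [QSym.zetaQ_of_mem hf, hstrip]
  · rw [compFun_apply_ne (QSym.grade k) _ hn hf]
    change 0 = (QSym.M k).repr f [a]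
    by_contra h0
    have := (QSym.mem_grade k n f).1 hf _ (Ne.symm h0)
    exact hn (by simpa [wt] using this.symm)

/-- The component of ζ_Q in degree a is the coordinate at the one-letter word (a), and convolution
of coordinate functionals concatenates words. Hence ζ_Q alone determines all coordinates, which is
the source of uniqueness. -/
theorem QSym.wordFun_zetaFun (w : List ℕ+) :
    wordFun (QSym.grade k) (QSym.zetaFun k) w = toConv ((QSym.M k).coord w) := by
  induction w with
  | nil =>
    rw [wordFun_nil]
    ext f
    exact QSym.counit_apply k f
  | cons a w ih =>
    rw [wordFun_cons, ih, QSym.compFun_zetaFun]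
    ext f
    have := QSym.MM_repr_map (k := k) LinearMap.id LinearMap.id
      (Coalgebra.comul (R := k) f) [a] w
    rw [TensorProduct.map_id] at this
    rw [LinearMap.convMul_apply]
    exact this.symm.trans (QSym.repr_comul k f [a] w)

theorem wordFun_comp {B : Type*} [Ring B] [Bialgebra k B] {ℬ : ℕ → Submodule k B}
    [GradedAlgebra ℬ] (h : IsGradedConnected 𝒜) (Φ : H →ₐc[k] B) (hΦ : PreservesGrading 𝒜 ℬ Φ)
    (φ : WithConv (B →ₗ[k] k)) (w : List ℕ+) (x : H) :
    wordFun 𝒜 (toConv (φ.ofConv ∘ₗ (Φ : H →ₗ[k] B))) w x = wordFun ℬ φ w (Φ x) := by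
  suffices hw : wordFun 𝒜 (toConv (φ.ofConv ∘ₗ (Φ : H →ₗ[k] B))) w =
      toConv ((wordFun ℬ φ w).ofConv ∘ₗ (Φ : H →ₗ[k] B)) from
    congrArg (fun f : WithConv (H →ₗ[k] k) => f x) hw
  induction w with
  | nil =>
    ext x
    change algebraMap k k (Coalgebra.counit (R := k) x) =
      algebraMap k k (Coalgebra.counit (R := k) (Φ x))
    rw [CoalgHomClass.counit_comp_apply]
  | cons a w ih =>
    rw [wordFun_cons, wordFun_cons, ih]
    have hcomp : compFun 𝒜 (toConv (φ.ofConv ∘ₗ (Φ : H →ₗ[k] B))) a =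
        toConv ((compFun ℬ φ a).ofConv ∘ₗ (Φ : H →ₗ[k] B)) := by
      ext1
      refine h.linearMap_ext fun n x hx => ?_
      change _ = compFun ℬ φ a (Φ x)
      by_cases hn : n = a
      · subst hn
        rw [compFun_apply_same 𝒜 _ hx, compFun_apply_same ℬ _ (hΦ _ x hx)]
        rfl
      · rw [compFun_apply_ne 𝒜 _ hn hx, compFun_apply_ne ℬ _ hn (hΦ _ x hx)]
    rw [hcomp]
    apply ofConv_injective
    exact (LinearMap.convMul_comp_coalgHom_distrib _ _ (Φ : H →ₗc[k] B)).symm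

/-- A graded morphism to `QSym` is determined by the character it induces. -/
theorem eq_toQSym (h : IsGradedConnected 𝒜) {φ : WithConv (H →ₗ[k] k)} (Φ : H →ₐc[k] QSym k)
    (hΦ : PreservesGrading 𝒜 (QSym.grade k) Φ) (hζ : ∀ x, QSym.zetaQ k (Φ x) = φ x) (x : H) :
    Φ x = toQSym h φ x := by
  apply (QSym.M k).ext_elem
  intro w
  have hφ : φ = toConv ((QSym.zetaFun k).ofConv ∘ₗ (Φ : H →ₗ[k] QSym k)) := by
    ext x
    exact (hζ x).symm
  rw [repr_toQSym, hφ, wordFun_comp h Φ hΦ, QSym.wordFun_zetaFun]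
  rfl

/-- In degree n, ζ_Q reads off the coefficient of the word (n), which is φ_n by construction. -/
theorem zetaQ_toQSym (h : IsGradedConnected 𝒜) {φ : WithConv (H →ₗ[k] k)} (hφ : φ 1 = 1)
    (x : H) : QSym.zetaQ k (toQSym h φ x) = φ x := by
  suffices hf : (QSym.zetaQ k).toLinearMap ∘ₗ toQSym h φ = φ.ofConv from
    LinearMap.congr_fun hf x
  refine h.linearMap_ext fun n x hx => ?_
  change QSym.zetaQ k (toQSym h φ x) = φ x
  rw [QSym.zetaQ_of_mem (toQSym_mem h φ n x hx), repr_toQSym, wordFun_strip_cons h hφ]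
  change (compFun 𝒜 φ n * 1) x = _
  rw [mul_one, compFun_apply_same 𝒜 φ hx]

theorem hom_ext (h : IsGradedConnected 𝒜) {Φ Φ' : H →ₐc[k] QSym k}
    (hΦ : PreservesGrading 𝒜 (QSym.grade k) Φ) (hΦ' : PreservesGrading 𝒜 (QSym.grade k) Φ')
    (hζ : ∀ x, QSym.zetaQ k (Φ x) = QSym.zetaQ k (Φ' x)) : Φ = Φ' := by
  refine BialgHom.ext fun x => ?_
  let φ : WithConv (H →ₗ[k] k) := toConv ((QSym.zetaFun k).ofConv ∘ₗ (Φ' : H →ₗ[k] QSym k))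
  rw [eq_toQSym h (φ := φ) Φ hΦ hζ, eq_toQSym h (φ := φ) Φ' hΦ' fun _ => rfl]

end Words

/-! ### The grading of `QSym` -/

section QSymGraded

variable (k : Type*) [Field k]

theorem QSym.isGradedConnected : IsGradedConnected (k := k) (H := QSym k) (QSym.grade k) where
  internal := DirectSum.Decomposition.isInternal (QSym.grade k)
  one_mem := SetLike.GradedOne.one_mem
  mul_mem _ _ _ hx _ hy := SetLike.GradedMul.mul_mem hx hy
  comul_mem n x hx := by
    have hle : QSym.grade k n ≤ (⨆ p ∈ Finset.HasAntidiagonal.antidiagonal n,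
        tensorSub (QSym.grade k p.1) (QSym.grade k p.2)).comap (Coalgebra.comul (R := k)) := by
      rw [QSym.grade, Submodule.span_le]
      rintro _ ⟨w, hw, rfl⟩
      have h1 : Coalgebra.comul (R := k) (QSym.M k w) = ∑ i ∈ Finset.range (w.length + 1),
          QSym.M k (w.take i) ⊗ₜ[k] QSym.M k (w.drop i) := Module.Basis.constr_basis _ _ _ _
      rw [SetLike.mem_coe, Submodule.mem_comap, h1]
      refine Submodule.sum_mem _ fun i _ => ?_
      have hi : (wt (w.take i), wt (w.drop i)) ∈ Finset.HasAntidiagonal.antidiagonal n := by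
        rw [Finset.HasAntidiagonal.mem_antidiagonal, ← wt_append, List.take_append_drop]
        exact hw
      exact (le_iSup₂_of_le (f := fun (p : ℕ × ℕ) _ =>
        tensorSub (QSym.grade k p.1) (QSym.grade k p.2)) _ hi le_rfl)
        (tmul_mem_tensorSub (Submodule.subset_span ⟨_, rfl, rfl⟩)
          (Submodule.subset_span ⟨_, rfl, rfl⟩))
    exact hle hx
  counit_eq_zero n hn x hx := by
    refine (QSym.counit_apply k x).trans ?_
    by_contra h0
    exact hn ((QSym.mem_grade k n x).1 hx _ h0).symm
  connected := by
    rw [QSym.grade, ← QSym.M_nil]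
    congr 1
    have : {w : List ℕ+ | wt w = 0} = {[]} := by
      ext w
      cases w with
      | nil => simp [wt]
      | cons a w => simp [wt]
    rw [this, Set.image_singleton]

theorem QSym.finite_grade (n : ℕ) : Module.Finite k (QSym.grade k n) :=
  Module.Finite.span_of_finite k
    (((finite_words n).subset fun _ hw => le_of_eq hw).image (QSym.M k))

end QSymGraded

/-! ### Graded sub-bialgebras and images of morphisms -/

section RestrictGraded

theorem finite_comap_val {k : Type*} [Field k] {H : Type*} [Ring H] [Algebra k H]
    {𝒜 : ℕ → Submodule k H} (hfin : ∀ n, Module.Finite k (𝒜 n)) (B : Subalgebra k H) (n : ℕ) :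
    Module.Finite k ((𝒜 n).comap B.val.toLinearMap) := by
  have := hfin n
  let f : (𝒜 n).comap B.val.toLinearMap →ₗ[k] 𝒜 n := B.val.toLinearMap.restrict fun x hx => hx
  refine Module.Finite.of_injective f fun x y hxy => ?_
  exact Subtype.ext (Subtype.ext (congrArg (fun z : 𝒜 n => (z : H)) hxy))

variable {k : Type*} [Field k] {H : Type*} [Ring H] [Bialgebra k H] {𝒜 : ℕ → Submodule k H}
  [GradedAlgebra 𝒜]

/-- Expresses homogeneity of Δ as an equation, which can be pulled back along the injection B ⊗ B →
H ⊗ H in `IsGradedConnected.restrict`. -/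
theorem IsGradedConnected.comul_eq_sum_proj (h : IsGradedConnected 𝒜) {n : ℕ} {x : H}
    (hx : x ∈ 𝒜 n) : Coalgebra.comul (R := k) x = ∑ p ∈ Finset.HasAntidiagonal.antidiagonal n,
      TensorProduct.map (GradedAlgebra.proj 𝒜 p.1) (GradedAlgebra.proj 𝒜 p.2)
        (Coalgebra.comul (R := k) x) := by
  have := h.comul_one_mem hx (LinearMap.eqLocus LinearMap.id
    (∑ p ∈ Finset.HasAntidiagonal.antidiagonal n,
      TensorProduct.map (GradedAlgebra.proj 𝒜 p.1) (GradedAlgebra.proj 𝒜 p.2)))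
    fun p q hpq a ha b hb => by
      rw [LinearMap.mem_eqLocus, LinearMap.sum_apply, Finset.sum_eq_single (p, q)]
      · simp [proj_of_mem_same 𝒜 ha, proj_of_mem_same 𝒜 hb]
      · rintro ⟨p', q'⟩ hpq' hne
        rw [Finset.HasAntidiagonal.mem_antidiagonal] at hpq'
        have : p ≠ p' := by
          rintro rfl
          exact hne (by simp only [Prod.mk.injEq, true_and]; omega)
        rw [TensorProduct.map_tmul, proj_of_mem_ne 𝒜 this ha, TensorProduct.zero_tmul]
      · intro hn
        exact absurd (Finset.HasAntidiagonal.mem_antidiagonal.2 hpq) hn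
  rw [LinearMap.mem_eqLocus, LinearMap.sum_apply] at this
  exact this

theorem IsGradedConnected.restrict (h : IsGradedConnected 𝒜) (B : Subalgebra k H)
    (hB : IsSubcoalgebra (Subalgebra.toSubmodule B))
    (hgr : ∀ b ∈ B, ∀ n, (DirectSum.decompose 𝒜 b n : H) ∈ B) :
    letI := restrictBialgebra B hB
    IsGradedConnected (k := k) (H := B) fun n => (𝒜 n).comap B.val.toLinearMap := by
  let _ := restrictBialgebra B hB
  -- B is stable under taking homogeneous parts, so the projections of H restrict to B and provide
  -- its grading.
  let π : ℕ → B →ₗ[k] B := fun n =>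
    (GradedAlgebra.proj 𝒜 n).restrict (p := Subalgebra.toSubmodule B)
      (q := Subalgebra.toSubmodule B) fun b hb => hgr b hb n
  have hπ : ∀ n b, π n b ∈ (𝒜 n).comap B.val.toLinearMap := fun n b =>
    SetLike.coe_mem (DirectSum.decompose 𝒜 (b : H) n)
  refine ⟨?_, h.one_mem, fun m n x hx y hy => h.mul_mem m n x hx y hy, fun n x hx => ?_,
    fun n hn x hx => h.counit_eq_zero n hn x hx, ?_⟩
  · rw [DirectSum.isInternal_submodule_iff_iSupIndep_and_iSup_eq_top]
    constructor
    · intro n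
      rw [Submodule.disjoint_def]
      intro x hx hx'
      have hind := h.internal.submodule_iSupIndep n
      rw [Submodule.disjoint_def] at hind
      refine Subtype.ext (hind x hx ?_)
      have hle : (⨆ j, ⨆ (_ : j ≠ n), (𝒜 j).comap B.val.toLinearMap) ≤
          (⨆ j, ⨆ (_ : j ≠ n), 𝒜 j).comap B.val.toLinearMap :=
        iSup₂_le fun j hj => Submodule.comap_mono (le_iSup₂_of_le j hj le_rfl)
      exact hle hx'
    · rw [eq_top_iff]
      rintro b -
      classical
      have hb : b = ∑ n ∈ (DirectSum.decompose 𝒜 (b : H)).support, π n b := by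
        apply Subtype.ext
        rw [AddSubmonoidClass.coe_finsetSum]
        exact (DirectSum.sum_support_decompose 𝒜 (b : H)).symm
      rw [hb]
      exact Submodule.sum_mem _ fun n _ => Submodule.mem_iSup_of_mem n (hπ n b)
  · have hcomm : ∀ (p : ℕ × ℕ) (t : B ⊗[k] B),
        inclTensor B (TensorProduct.map (π p.1) (π p.2) t) =
        TensorProduct.map (GradedAlgebra.proj 𝒜 p.1) (GradedAlgebra.proj 𝒜 p.2)
          (inclTensor B t) := by
      intro p t
      induction t with
      | zero => simp
      | add x y hx hy => simp only [map_add, hx, hy]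
      | tmul x y => rfl
    have hx' : restrictComul B hB x = ∑ p ∈ Finset.HasAntidiagonal.antidiagonal n,
        TensorProduct.map (π p.1) (π p.2) (restrictComul B hB x) := by
      apply inclTensor_injective B
      rw [map_sum]
      simp only [hcomm, inclTensor_restrictComul]
      exact h.comul_eq_sum_proj hx
    change restrictComul B hB x ∈ _
    rw [hx']
    refine Submodule.sum_mem _ fun p hp => Submodule.mem_iSup_of_mem p
      (Submodule.mem_iSup_of_mem hp ?_)
    generalize restrictComul B hB x = t
    induction t with
    | zero => simp
    | add x y hx hy => rw [map_add]; exact Submodule.add_mem _ hx hy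
    | tmul x y => exact tmul_mem_tensorSub (hπ _ _) (hπ _ _)
  · refine le_antisymm (fun x hx => ?_) ?_
    · have hx0 : (x : H) ∈ 𝒜 0 := hx
      rw [h.connected] at hx0
      obtain ⟨c, hc⟩ := Submodule.mem_span_singleton.1 hx0
      exact Submodule.mem_span_singleton.2 ⟨c, Subtype.ext hc⟩
    · rw [Submodule.span_singleton_le_iff_mem]
      exact h.one_mem

/-- A morphism of bialgebras whose image lies in a sub-bialgebra, with restricted codomain. -/
abbrev codRestrictHom {A : Type*} [Ring A] [Bialgebra k A] (Φ : A →ₐc[k] H) (B : Subalgebra k H)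
    (hB : IsSubcoalgebra (Subalgebra.toSubmodule B)) (hΦ : ∀ a, Φ a ∈ B) :
    letI := restrictBialgebra B hB
    A →ₐc[k] B :=
  letI := restrictBialgebra B hB
  BialgHom.ofAlgHom ((Φ : A →ₐ[k] H).codRestrict B hΦ)
    (AlgHom.ext fun a => CoalgHomClass.counit_comp_apply Φ a)
    (AlgHom.ext fun a => by
      apply inclTensor_injective B
      change _ = inclTensor B (restrictComul B hB ⟨Φ a, hΦ a⟩)
      rw [inclTensor_restrictComul]
      refine Eq.trans ?_ (CoalgHomClass.map_comp_comul_apply Φ a)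
      change inclTensor B (TensorProduct.map ((Φ : A →ₐ[k] H).codRestrict B hΦ).toLinearMap
        ((Φ : A →ₐ[k] H).codRestrict B hΦ).toLinearMap (Coalgebra.comul (R := k) a)) = _
      generalize Coalgebra.comul (R := k) a = t
      induction t with
      | zero => simp
      | add x y hx hy => simp only [map_add, hx, hy]
      | tmul x y => rfl)

/-- The range of a graded morphism is a graded subcoalgebra. If φ and ψ agree on it, it is one of
the subspaces whose sum is S(φ, ψ). -/
theorem mem_largestSub_of_hom {A : Type*} [Ring A] [Bialgebra k A] {ℬ : ℕ → Submodule k A}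
    [GradedAlgebra ℬ] (hA : IsGradedConnected ℬ) (Φ : A →ₐc[k] H) (hΦ : PreservesGrading ℬ 𝒜 Φ)
    {φ ψ : H →ₐ[k] k} (hag : ∀ a, φ (Φ a) = ψ (Φ a)) (a : A) : Φ a ∈ largestSub 𝒜 φ ψ := by
  have hmem : LinearMap.range (Φ : A →ₗ[k] H) ∈ {C : Submodule k H |
      (∀ h ∈ C, ∀ n, (DirectSum.decompose 𝒜 h n : H) ∈ C) ∧ IsSubcoalgebra C ∧
        ∀ h ∈ C, φ.toLinearMap h = ψ.toLinearMap h} := by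
    refine ⟨?_, ?_, ?_⟩
    · rintro _ ⟨a, rfl⟩ n
      have hcomm : GradedAlgebra.proj 𝒜 n ∘ₗ (Φ : A →ₗ[k] H) =
          (Φ : A →ₗ[k] H) ∘ₗ GradedAlgebra.proj ℬ n := by
        refine hA.linearMap_ext fun m x hx => ?_
        change GradedAlgebra.proj 𝒜 n (Φ x) = Φ (GradedAlgebra.proj ℬ n x)
        by_cases hmn : m = n
        · subst hmn
          rw [proj_of_mem_same 𝒜 (hΦ m x hx), proj_of_mem_same ℬ hx]
        · rw [proj_of_mem_ne 𝒜 hmn (hΦ m x hx), proj_of_mem_ne ℬ hmn hx, map_zero]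
      exact ⟨_, (LinearMap.congr_fun hcomm a).symm⟩
    · rintro _ ⟨a, rfl⟩
      have := CoalgHomClass.map_comp_comul_apply Φ a
      change Coalgebra.comul (R := k) (Φ a) ∈ _
      rw [← this]
      generalize Coalgebra.comul (R := k) a = t
      induction t with
      | zero => simp
      | add x y hx hy => rw [map_add]; exact Submodule.add_mem _ hx hy
      | tmul x y => exact tmul_mem_tensorSub ⟨x, rfl⟩ ⟨y, rfl⟩
    · rintro _ ⟨a, rfl⟩
      exact hag a
  exact (le_sSup hmem : LinearMap.range (Φ : A →ₗ[k] H) ≤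
    largestSubcoalgebra 𝒜 φ.toLinearMap ψ.toLinearMap) ⟨a, rfl⟩

end RestrictGraded

/-! ### The gradings of Π₊ and Π₋ -/

section PiGraded

variable (k : Type*) [Field k]

theorem isGradedConnected_PiPlus :
    IsGradedConnected (k := k) (H := PiPlus k) (gradePiPlus k) :=
  (QSym.isGradedConnected k).restrict (PiPlus k) (isSubcoalgebra_PiPlus k)
    (largestSubcoalgebra_mem (QSym.grade k) _ _).1

theorem isGradedConnected_PiMinus :
    IsGradedConnected (k := k) (H := PiMinus k) (gradePiMinus k) :=
  (QSym.isGradedConnected k).restrict (PiMinus k) (isSubcoalgebra_PiMinus k)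
    (largestSubcoalgebra_mem (QSym.grade k) _ _).1

end PiGraded

/-! ### Existence of the even-odd decomposition -/

section Characters

variable {k : Type*} [Field k] {H : Type*} [CommRing H] [HopfAlgebra k H]

/-- A character, as a linear functional. -/
def charFun (φ : WithConv (H →ₐ[k] k)) : WithConv (H →ₗ[k] k) := toConv φ.ofConv.toLinearMap

/-- Transfers to characters the identities proved for linear functionals, where differences are
available. -/
theorem charFun_injective : Function.Injective (charFun (k := k) (H := H)) := fun _ _ h =>
  ofConv_injective (AlgHom.toLinearMap_injective (toConv_injective h))

theorem charFun_one_apply (φ : WithConv (H →ₐ[k] k)) : charFun φ 1 = 1 := map_one φ.ofConv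

theorem charFun_mul (φ ψ : WithConv (H →ₐ[k] k)) :
    charFun (φ * ψ) = charFun φ * charFun ψ := AlgHom.toLinearMap_convMul φ ψ

theorem charFun_one : charFun (1 : WithConv (H →ₐ[k] k)) = 1 := AlgHom.toLinearMap_convOne

variable {𝒜 : ℕ → Submodule k H}

open IsGradedConnected

/-- Multiplicativity of ψ gives ψ * ψ = ψ∘m∘Δ = ψ∘T, so ρ∘T⁻¹ is a square root of ρ. -/
theorem exists_sq_eq (h : IsGradedConnected 𝒜) (hk : (2 : k) ≠ 0)
    (hfin : ∀ n, Module.Finite k (𝒜 n)) (ρ : WithConv (H →ₐ[k] k)) : ∃ ψ, ψ * ψ = ρ := by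
  let T : H ≃ₐ[k] H := AlgEquiv.ofBijective (sqHom k H) (h.sqHom_bijective hk hfin)
  let ψ : H →ₐ[k] k := ρ.ofConv.comp (T.symm : H →ₐ[k] H)
  refine ⟨toConv ψ, ?_⟩
  have hψ : (Algebra.TensorProduct.lmul' k).comp (Algebra.TensorProduct.map ψ ψ) =
      ψ.comp (Algebra.TensorProduct.lmul' k) := by ext <;> simp
  rw [AlgHom.convMul_def, ← AlgHom.comp_assoc, hψ, AlgHom.comp_assoc]
  ext x
  exact congrArg ρ.ofConv (T.symm_apply_apply x)

theorem sq_injective (h : IsGradedConnected 𝒜) (hk : (2 : k) ≠ 0) {φ ψ : WithConv (H →ₐ[k] k)}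
    (hsq : φ * φ = ψ * ψ) : φ = ψ :=
  charFun_injective (h.conv_sq_injective hk (charFun_one_apply φ) (charFun_one_apply ψ)
    (by rw [← charFun_mul, hsq, charFun_mul]))

variable [GradedAlgebra 𝒜]

theorem charFun_barChar (φ : WithConv (H →ₐ[k] k)) :
    charFun (barChar 𝒜 φ) = barFun 𝒜 (charFun φ) := rfl

theorem barChar_mul (h : IsGradedConnected 𝒜) (φ ψ : WithConv (H →ₐ[k] k)) :
    barChar 𝒜 (φ * ψ) = barChar 𝒜 φ * barChar 𝒜 ψ :=
  charFun_injective (by simp only [charFun_barChar, charFun_mul, h.barFun_mul])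

theorem barChar_barChar (h : IsGradedConnected 𝒜) (φ : WithConv (H →ₐ[k] k)) :
    barChar 𝒜 (barChar 𝒜 φ) = φ :=
  charFun_injective (by simp only [charFun_barChar, h.barFun_barFun])

theorem barChar_inv (h : IsGradedConnected 𝒜) (φ : WithConv (H →ₐ[k] k)) :
    barChar 𝒜 φ⁻¹ = (barChar 𝒜 φ)⁻¹ := by
  refine eq_inv_of_mul_eq_one_left ?_
  rw [← barChar_mul h, inv_mul_cancel]
  exact charFun_injective (by rw [charFun_barChar, charFun_one, h.barFun_one])

/-- If ζ = φψ with φ even and ψ odd, then ζ̄ = φψ⁻¹, so ψ² must be ζ̄⁻¹ζ. Conversely, let ψ be a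
square root of ζ̄⁻¹ζ. The involution inverts ζ̄⁻¹ζ, so ψ̄ and ψ⁻¹ have the same square and coincide,
and then ζψ⁻¹ is even. -/
theorem exists_even_mul_odd (h : IsGradedConnected 𝒜) (hk : (2 : k) ≠ 0)
    (hfin : ∀ n, Module.Finite k (𝒜 n)) (ζ : WithConv (H →ₐ[k] k)) :
    ∃ φ ψ, IsEvenChar 𝒜 φ ∧ IsOddChar 𝒜 ψ ∧ ζ = φ * ψ := by
  obtain ⟨ψ, hψ⟩ := exists_sq_eq h hk hfin ((barChar 𝒜 ζ)⁻¹ * ζ)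
  have hodd : barChar 𝒜 ψ = ψ⁻¹ := by
    refine sq_injective h hk ?_
    rw [← barChar_mul h, hψ, ← mul_inv_rev, hψ, barChar_mul h, barChar_inv h, barChar_barChar h,
      mul_inv_rev, inv_inv]
  refine ⟨ζ * ψ⁻¹, ψ, ?_, hodd, by rw [inv_mul_cancel_right]⟩
  rw [IsEvenChar, barChar_mul h, barChar_inv h, hodd, inv_inv, eq_mul_inv_iff_mul_eq, mul_assoc, hψ,
    mul_inv_cancel_left]

theorem IsEvenChar.barFun_charFun {φ : WithConv (H →ₐ[k] k)} (hφ : IsEvenChar 𝒜 φ) :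
    barFun 𝒜 (charFun φ) = charFun φ := congrArg charFun hφ

theorem IsOddChar.barFun_charFun {φ : WithConv (H →ₐ[k] k)} (hφ : IsOddChar 𝒜 φ) :
    barFun 𝒜 (charFun φ) * charFun φ = 1 := by
  rw [← charFun_barChar, ← charFun_mul, show barChar 𝒜 φ = φ⁻¹ from hφ, inv_mul_cancel,
    charFun_one]

end Characters

/-! ### Pullback of functionals along morphisms -/

section Pullback

variable {k : Type*} [Field k] {A B : Type*} [Ring A] [Bialgebra k A] [Ring B] [Bialgebra k B]

/-- The pullback of a linear functional along a morphism of bialgebras. -/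
def pullFun (Φ : A →ₐc[k] B) (φ : WithConv (B →ₗ[k] k)) : WithConv (A →ₗ[k] k) :=
  toConv (φ.ofConv ∘ₗ (Φ : A →ₗ[k] B))

theorem pullFun_mul (Φ : A →ₐc[k] B) (φ ψ : WithConv (B →ₗ[k] k)) :
    pullFun Φ (φ * ψ) = pullFun Φ φ * pullFun Φ ψ :=
  ofConv_injective (LinearMap.convMul_comp_coalgHom_distrib φ ψ (Φ : A →ₗc[k] B))

theorem pullFun_one (Φ : A →ₐc[k] B) : pullFun Φ (1 : WithConv (B →ₗ[k] k)) = 1 := by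
  ext x
  change algebraMap k k (Coalgebra.counit (R := k) (Φ x)) =
    algebraMap k k (Coalgebra.counit (R := k) x)
  rw [CoalgHomClass.counit_comp_apply]

open IsGradedConnected in
theorem barFun_pullFun {𝒜 : ℕ → Submodule k A} [GradedAlgebra 𝒜] {ℬ : ℕ → Submodule k B}
    [GradedAlgebra ℬ] (h : IsGradedConnected 𝒜) {Φ : A →ₐc[k] B} (hΦ : PreservesGrading 𝒜 ℬ Φ)
    (φ : WithConv (B →ₗ[k] k)) : barFun 𝒜 (pullFun Φ φ) = pullFun Φ (barFun ℬ φ) := by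
  ext1
  refine h.linearMap_ext fun n x hx => ?_
  rw [barFun_apply_of_mem _ hx]
  exact (barFun_apply_of_mem φ (hΦ n x hx)).symm

/-- Commutativity of k suffices. The source may be noncommutative, which is why multiplicative
linear functionals are used there in place of the group of characters. -/
theorem conv_multiplicative {f g : WithConv (A →ₗ[k] k)} (hf : ∀ x y, f (x * y) = f x * f y)
    (hg : ∀ x y, g (x * y) = g x * g y) (x y : A) : (f * g) (x * y) = (f * g) x * (f * g) y := by
  rw [conv_apply_mul, (Coalgebra.Repr.arbitrary k x).convMul_apply,
    (Coalgebra.Repr.arbitrary k y).convMul_apply, Finset.sum_mul_sum]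
  refine Finset.sum_congr rfl fun i _ => Finset.sum_congr rfl fun j _ => ?_
  rw [hf, hg]
  ring

end Pullback

/-! ### Morphisms to Π₊ and Π₋, and the universal property -/

section EvenOddMaps

open IsGradedConnected

variable {k : Type*} [Field k] {A : Type*} [Ring A] [Bialgebra k A] {𝒜 : ℕ → Submodule k A}
  [GradedAlgebra 𝒜]

theorem pullFun_inv_mul (Φ : A →ₐc[k] QSym k) :
    pullFun Φ (charFun (toConv (QSym.zetaQ k))⁻¹) * pullFun Φ (QSym.zetaFun k) = 1 := by
  have := charFun_mul (toConv (QSym.zetaQ k))⁻¹ (toConv (QSym.zetaQ k))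
  rw [inv_mul_cancel, charFun_one] at this
  rw [← pullFun_one Φ, this, pullFun_mul]
  rfl

theorem inclPlus_injective : Function.Injective (inclPlus k) := Subtype.val_injective

theorem inclMinus_injective : Function.Injective (inclMinus k) := Subtype.val_injective

theorem barFun_zetaFun_of_mem_PiPlus {f : QSym k} (hf : f ∈ PiPlus k) :
    barFun (QSym.grade k) (QSym.zetaFun k) f = QSym.zetaFun k f :=
  (largestSubcoalgebra_mem (QSym.grade k)
    (barChar (QSym.grade k) (toConv (QSym.zetaQ k))).ofConv.toLinearMap
    (toConv (QSym.zetaQ k)).ofConv.toLinearMap).2.2 f hf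

theorem barFun_zetaFun_of_mem_PiMinus {f : QSym k} (hf : f ∈ PiMinus k) :
    barFun (QSym.grade k) (QSym.zetaFun k) f = charFun (toConv (QSym.zetaQ k))⁻¹ f :=
  (largestSubcoalgebra_mem (QSym.grade k)
    (barChar (QSym.grade k) (toConv (QSym.zetaQ k))).ofConv.toLinearMap
    (toConv (QSym.zetaQ k))⁻¹.ofConv.toLinearMap).2.2 f hf

/-- The involution commutes with pullback along graded morphisms, and ζ̄_Q and ζ_Q agree on Π₊. The
converse is `exists_hom_PiPlus`. -/
theorem barFun_pullFun_inclPlus (h : IsGradedConnected 𝒜) {α : A →ₐc[k] PiPlus k}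
    (hα : PreservesGrading 𝒜 (gradePiPlus k) α) :
    barFun 𝒜 (pullFun ((inclPlus k).comp α) (QSym.zetaFun k)) =
      pullFun ((inclPlus k).comp α) (QSym.zetaFun k) := by
  rw [barFun_pullFun (ℬ := QSym.grade k) h fun n x hx => hα n x hx]
  ext x
  exact barFun_zetaFun_of_mem_PiPlus (α x).2

theorem barFun_pullFun_inclMinus (h : IsGradedConnected 𝒜) {α : A →ₐc[k] PiMinus k}
    (hα : PreservesGrading 𝒜 (gradePiMinus k) α) :
    barFun 𝒜 (pullFun ((inclMinus k).comp α) (QSym.zetaFun k)) *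
      pullFun ((inclMinus k).comp α) (QSym.zetaFun k) = 1 := by
  have e : pullFun ((inclMinus k).comp α) (barFun (QSym.grade k) (QSym.zetaFun k)) =
      pullFun ((inclMinus k).comp α) (charFun (toConv (QSym.zetaQ k))⁻¹) := by
    ext x
    exact barFun_zetaFun_of_mem_PiMinus (α x).2
  rw [barFun_pullFun (ℬ := QSym.grade k) h fun n x hx => hα n x hx, e, pullFun_inv_mul]

/-- Evenness of φ says that ζ̄_Q and ζ_Q agree on the image of the morphism induced by φ, so that
image lies in Π₊. -/
theorem exists_hom_PiPlus (h : IsGradedConnected 𝒜) {φ : WithConv (A →ₗ[k] k)} (hφ : φ 1 = 1)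
    (hmul : ∀ x y, φ (x * y) = φ x * φ y) (heven : barFun 𝒜 φ = φ) :
    ∃ Ψ : A →ₐc[k] PiPlus k, PreservesGrading 𝒜 (gradePiPlus k) Ψ ∧
      ∀ x, QSym.zetaQ k (inclPlus k (Ψ x)) = φ x := by
  let Φ := toQSymHom h hφ hmul
  have hΦ : PreservesGrading 𝒜 (QSym.grade k) Φ := toQSym_mem h φ
  have hζ : pullFun Φ (QSym.zetaFun k) = φ := by
    ext x
    exact zetaQ_toQSym h hφ x
  have hag : ∀ a, (barChar (QSym.grade k) (toConv (QSym.zetaQ k))).ofConv (Φ a) =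
      QSym.zetaQ k (Φ a) := fun a => by
    have h2 : pullFun Φ (barFun (QSym.grade k) (QSym.zetaFun k)) =
        pullFun Φ (QSym.zetaFun k) := by
      rw [← barFun_pullFun h hΦ, hζ, heven]
    exact congrArg (fun f : WithConv (A →ₗ[k] k) => f a) h2
  exact ⟨codRestrictHom Φ (PiPlus k) (isSubcoalgebra_PiPlus k) (mem_largestSub_of_hom h Φ hΦ hag),
    fun n x hx => hΦ n x hx, fun x => zetaQ_toQSym h hφ x⟩

theorem exists_hom_PiMinus (h : IsGradedConnected 𝒜) {φ : WithConv (A →ₗ[k] k)} (hφ : φ 1 = 1)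
    (hmul : ∀ x y, φ (x * y) = φ x * φ y) (hodd : barFun 𝒜 φ * φ = 1) :
    ∃ Ψ : A →ₐc[k] PiMinus k, PreservesGrading 𝒜 (gradePiMinus k) Ψ ∧
      ∀ x, QSym.zetaQ k (inclMinus k (Ψ x)) = φ x := by
  let Φ := toQSymHom h hφ hmul
  have hΦ : PreservesGrading 𝒜 (QSym.grade k) Φ := toQSym_mem h φ
  have hζ : pullFun Φ (QSym.zetaFun k) = φ := by
    ext x
    exact zetaQ_toQSym h hφ x
  have hag : ∀ a, (barChar (QSym.grade k) (toConv (QSym.zetaQ k))).ofConv (Φ a) =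
      (toConv (QSym.zetaQ k))⁻¹.ofConv (Φ a) := fun a => by
    -- The pullback of ζ_Q⁻¹ is a left inverse of φ, and φ̄ is a right inverse by the involution
    -- applied to φ̄φ = 1. The two therefore coincide.
    have h2 : barFun 𝒜 φ = pullFun Φ (charFun (toConv (QSym.zetaQ k))⁻¹) := by
      have h3 := pullFun_inv_mul Φ
      rw [hζ] at h3
      have h4 := congrArg (barFun 𝒜) hodd
      rw [h.barFun_mul, h.barFun_barFun, h.barFun_one] at h4
      exact (left_inv_eq_right_inv h3 h4).symm
    rw [← hζ, barFun_pullFun h hΦ] at h2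
    exact congrArg (fun f : WithConv (A →ₗ[k] k) => f a) h2
  exact ⟨codRestrictHom Φ (PiMinus k) (isSubcoalgebra_PiMinus k)
    (mem_largestSub_of_hom h Φ hΦ hag), fun n x hx => hΦ n x hx, fun x => zetaQ_toQSym h hφ x⟩

/-- The universal property of the product. -/
theorem existsUnique_lift (h : IsGradedConnected 𝒜) (hk : (2 : k) ≠ 0)
    {ζp ζm : WithConv (QSym k →ₐ[k] k)} (hζ : toConv (QSym.zetaQ k) = ζp * ζm)
    {Ψp : QSym k →ₐc[k] PiPlus k} {Ψm : QSym k →ₐc[k] PiMinus k}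
    (hΨp : PreservesGrading (QSym.grade k) (gradePiPlus k) Ψp)
    (hΨm : PreservesGrading (QSym.grade k) (gradePiMinus k) Ψm)
    (hζp : ∀ f, QSym.zetaQ k (inclPlus k (Ψp f)) = ζp.ofConv f)
    (hζm : ∀ f, QSym.zetaQ k (inclMinus k (Ψm f)) = ζm.ofConv f)
    {αp : A →ₐc[k] PiPlus k} {αm : A →ₐc[k] PiMinus k}
    (hαp : PreservesGrading 𝒜 (gradePiPlus k) αp) (hαm : PreservesGrading 𝒜 (gradePiMinus k) αm) :
    ∃! α : A →ₐc[k] QSym k, PreservesGrading 𝒜 (QSym.grade k) α ∧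
      Ψp.comp α = αp ∧ Ψm.comp α = αm := by
  let fp := fun β : A →ₐc[k] PiPlus k => pullFun ((inclPlus k).comp β) (QSym.zetaFun k)
  let fm := fun β : A →ₐc[k] PiMinus k => pullFun ((inclMinus k).comp β) (QSym.zetaFun k)
  -- Pulling ζ_Q = ζ₊ζ₋ back along any α expresses its functional through Ψ₊∘α and Ψ₋∘α alone. This
  -- serves both existence and uniqueness.
  have hfac : ∀ α : A →ₐc[k] QSym k, pullFun α (QSym.zetaFun k) =
      fp (Ψp.comp α) * fm (Ψm.comp α) := by
    intro α
    have e : QSym.zetaFun k = charFun ζp * charFun ζm := by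
      rw [← charFun_mul, ← hζ]
      rfl
    have ep : fp (Ψp.comp α) = pullFun α (charFun ζp) := by
      ext x
      exact hζp (α x)
    have em : fm (Ψm.comp α) = pullFun α (charFun ζm) := by
      ext x
      exact hζm (α x)
    rw [ep, em, ← pullFun_mul, e]
  have fp_one : ∀ β, fp β 1 = 1 := fun β => by
    change QSym.zetaQ k (inclPlus k (β 1)) = 1
    simp
  have fm_one : ∀ β, fm β 1 = 1 := fun β => by
    change QSym.zetaQ k (inclMinus k (β 1)) = 1
    simp
  have fp_mul : ∀ β x y, fp β (x * y) = fp β x * fp β y := fun β x y => by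
    change QSym.zetaQ k (inclPlus k (β (x * y))) = _
    rw [map_mul, map_mul, map_mul]
    rfl
  have fm_mul : ∀ β x y, fm β (x * y) = fm β x * fm β y := fun β x y => by
    change QSym.zetaQ k (inclMinus k (β (x * y))) = _
    rw [map_mul, map_mul, map_mul]
    rfl
  have hone : (fp αp * fm αm) 1 = 1 := by
    rw [LinearMap.convMul_apply, Bialgebra.comul_one, Algebra.TensorProduct.one_def,
      TensorProduct.map_tmul, LinearMap.mul'_apply, fp_one, fm_one, one_mul]
  let α := toQSymHom h hone (conv_multiplicative (fp_mul αp) (fm_mul αm))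
  have hα : PreservesGrading 𝒜 (QSym.grade k) α := toQSym_mem h _
  have hαζ : pullFun α (QSym.zetaFun k) = fp αp * fm αm := by
    ext x
    exact zetaQ_toQSym h hone x
  have hp : PreservesGrading 𝒜 (gradePiPlus k) (Ψp.comp α) := fun n x hx => hΨp n _ (hα n x hx)
  have hm : PreservesGrading 𝒜 (gradePiMinus k) (Ψm.comp α) := fun n x hx => hΨm n _ (hα n x hx)
  -- The functional of α now has two factorizations into even and odd parts, one from α₊ and α₋ and
  -- one from Ψ₊∘α and Ψ₋∘α.
  obtain ⟨e₁, e₂⟩ := h.even_mul_odd_unique hk (barFun_pullFun_inclPlus h hp)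
    (barFun_pullFun_inclPlus h hαp) (barFun_pullFun_inclMinus h hm)
    (barFun_pullFun_inclMinus h hαm) (fp_one _) (fm_one _) (fm_one _) ((hfac α).symm.trans hαζ)
  refine ⟨α, ⟨hα, ?_, ?_⟩, ?_⟩
  · have := hom_ext h (Φ := (inclPlus k).comp (Ψp.comp α)) (Φ' := (inclPlus k).comp αp)
      (fun n x hx => hp n x hx) (fun n x hx => hαp n x hx)
      fun x => congrArg (fun f : WithConv (A →ₗ[k] k) => f x) e₁
    exact BialgHom.ext fun x => inclPlus_injective (BialgHom.congr_fun this x)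
  · have := hom_ext h (Φ := (inclMinus k).comp (Ψm.comp α)) (Φ' := (inclMinus k).comp αm)
      (fun n x hx => hm n x hx) (fun n x hx => hαm n x hx)
      fun x => congrArg (fun f : WithConv (A →ₗ[k] k) => f x) e₂
    exact BialgHom.ext fun x => inclMinus_injective (BialgHom.congr_fun this x)
  · rintro β ⟨hβ, hβp, hβm⟩
    -- By the factorization, β induces the same functional as α, and a graded morphism to `QSym` is
    -- determined by its functional.
    refine hom_ext h hβ hα fun x => ?_
    have := (hfac β).trans (by rw [hβp, hβm, ← hαζ] : _ = pullFun α (QSym.zetaFun k))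
    exact congrArg (fun f : WithConv (A →ₗ[k] k) => f x) this

end EvenOddMaps

end CombHopf

end

/-! ### `QSym` as the product of Π₊ and Π₋ -/

theorem theoremT (k : Type*) [Field k] (hk : (2 : k) ≠ 0) :
    -- `QSym`, `Π₊`, `Π₋` are graded connected Hopf algebras with finite-dimensional components
    (IsGradedConnectedHopf (k := k) (H := QSym k) (QSym.grade k) ∧ ∀ n, Module.Finite k (QSym.grade k n)) ∧
    (IsGradedConnectedHopf (k := k) (H := PiPlus k) (gradePiPlus k) ∧ ∀ n, Module.Finite k (gradePiPlus k n)) ∧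
    (IsGradedConnectedHopf (k := k) (H := PiMinus k) (gradePiMinus k) ∧ ∀ n, Module.Finite k (gradePiMinus k n)) ∧
    ∃ (ζp ζm : WithConv (QSym k →ₐ[k] k))
      (Ψp : QSym k →ₐc[k] PiPlus k) (Ψm : QSym k →ₐc[k] PiMinus k),
      -- `ζ_Q = ζp * ζm` is the unique decomposition into an even and an odd character
      (IsEvenChar (QSym.grade k) ζp ∧ IsOddChar (QSym.grade k) ζm ∧
        toConv (QSym.zetaQ k) = ζp * ζm) ∧
      (∀ φ ψ : WithConv (QSym k →ₐ[k] k), IsEvenChar (QSym.grade k) φ →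
        IsOddChar (QSym.grade k) ψ → toConv (QSym.zetaQ k) = φ * ψ → φ = ζp ∧ ψ = ζm) ∧
      -- `Ψp` is the unique graded Hopf morphism `(QSym, ζp) → (QSym, ζ_Q)`; its image is in `Π₊`
      (PreservesGrading (QSym.grade k) (gradePiPlus k) Ψp ∧
        ∀ f, QSym.zetaQ k (inclPlus k (Ψp f)) = ζp.ofConv f) ∧
      (∀ Φ : QSym k →ₐc[k] QSym k, PreservesGrading (QSym.grade k) (QSym.grade k) Φ →
        (∀ f, QSym.zetaQ k (Φ f) = ζp.ofConv f) → Φ = (inclPlus k).comp Ψp) ∧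
      -- `Ψm` is the unique graded Hopf morphism `(QSym, ζm) → (QSym, ζ_Q)`; its image is in `Π₋`
      (PreservesGrading (QSym.grade k) (gradePiMinus k) Ψm ∧
        ∀ f, QSym.zetaQ k (inclMinus k (Ψm f)) = ζm.ofConv f) ∧
      (∀ Φ : QSym k →ₐc[k] QSym k, PreservesGrading (QSym.grade k) (QSym.grade k) Φ →
        (∀ f, QSym.zetaQ k (Φ f) = ζm.ofConv f) → Φ = (inclMinus k).comp Ψm) ∧
      -- the universal property of the product
      ∀ (H : Type*) [Ring H] [HopfAlgebra k H] (𝒜 : ℕ → Submodule k H),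
        IsGradedConnectedHopf 𝒜 →
        ∀ (αp : H →ₐc[k] PiPlus k) (αm : H →ₐc[k] PiMinus k),
          PreservesGrading 𝒜 (gradePiPlus k) αp → PreservesGrading 𝒜 (gradePiMinus k) αm →
          ∃! α : H →ₐc[k] QSym k, PreservesGrading 𝒜 (QSym.grade k) α ∧
            Ψp.comp α = αp ∧ Ψm.comp α = αm := by
  have hQ := QSym.isGradedConnected k
  have hfin := QSym.finite_grade k
  obtain ⟨ζp, ζm, hp, hm, hζ⟩ := exists_even_mul_odd hQ hk hfin (toConv (QSym.zetaQ k))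
  obtain ⟨Ψp, hΨp, hζp⟩ := exists_hom_PiPlus hQ (charFun_one_apply ζp) (map_mul ζp.ofConv)
    hp.barFun_charFun
  obtain ⟨Ψm, hΨm, hζm⟩ := exists_hom_PiMinus hQ (charFun_one_apply ζm) (map_mul ζm.ofConv)
    hm.barFun_charFun
  refine ⟨⟨hQ.isGradedConnectedHopf, hfin⟩,
    ⟨(isGradedConnected_PiPlus k).isGradedConnectedHopf, finite_comap_val hfin (PiPlus k)⟩,
    ⟨(isGradedConnected_PiMinus k).isGradedConnectedHopf, finite_comap_val hfin (PiMinus k)⟩,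
    ζp, ζm, Ψp, Ψm, ⟨hp, hm, hζ⟩, fun φ ψ hφ hψ hφψ => ?_, ⟨hΨp, hζp⟩, fun Φ hΦ hΦζ => ?_,
    ⟨hΨm, hζm⟩, fun Φ hΦ hΦζ => ?_, ?_⟩
  · obtain ⟨e₁, e₂⟩ := hQ.even_mul_odd_unique hk hφ.barFun_charFun hp.barFun_charFun
      hψ.barFun_charFun hm.barFun_charFun (charFun_one_apply φ) (charFun_one_apply ψ)
      (charFun_one_apply ζm) (by rw [← charFun_mul, ← charFun_mul, ← hφψ, hζ])
    exact ⟨charFun_injective e₁, charFun_injective e₂⟩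
  · exact hom_ext hQ hΦ (fun n x hx => hΨp n x hx) fun x => (hΦζ x).trans (hζp x).symm
  · exact hom_ext hQ hΦ (fun n x hx => hΨm n x hx) fun x => (hΦζ x).trans (hζm x).symm
  · intro H _ _ 𝒜 hH αp αm hαp hαm
    let _ := hH.isGradedConnected.gradedAlgebra
    exact existsUnique_lift hH.isGradedConnected hk hζ hΨp hΨm hζp hζm hαp hαm
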